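/- For integers $d\ge 0$ and $k_1,\dots,k_d\ge 1$ with $k_d\ge 2$ (if $d\ge1$), let $$\zeta(k_1,\dots,k_d)=\sum_{0<m_1<\cdots<m_d}\frac{1}{m_1^{k_1}\cdots m_d^{k_d}}$$ be the multiple zeta value of weight $k_1+\cdots+k_d$ and depth $d$, where the multiple zeta value of depth $0$ is $1$. **Theorem (parity result for multiple zeta values).** Let $d\ge 1$ and let $k_1,\dots,k_d$ be positive integers with $k_d\ge2$ such that the weight and the depth have opposite parity, that is, $k_1+\cdots+k_d\not\equiv d\pmod 2$. Then $\zeta(k_1,\dots,k_d)$ is a $\mathbb{Q}[\pi^2]$-linear combination of multiple zeta values of depth at most $d-1$; that is, it lies in the $\mathbb{Q}[\pi^2]$-submodule of $\mathbb{R}$ generated by the multiple zeta values of depth at most $d-1$. -/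

import Mathlib

namespace MZV

/-- An index `(k_1, …, k_d)` of depth `d` is admissible if all its entries are positive and its
last entry is at least `2`. The empty index (`d = 0`) is admissible. -/
def Admissible {d : ℕ} (k : Fin d → ℕ) : Prop :=
  (∀ i, 1 ≤ k i) ∧ ∀ i : Fin d, (i : ℕ) + 1 = d → 2 ≤ k i

/-- The tuples of integers `0 < m_1 < ⋯ < m_d`. -/
abbrev Tuples (d : ℕ) : Type := {m : Fin d → ℕ // (∀ i, 0 < m i) ∧ StrictMono m}

/-- The summand `1 / (m_1 ^ k_1 ⋯ m_d ^ k_d)`. -/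
noncomputable def term {d : ℕ} (k : Fin d → ℕ) (m : Tuples d) : ℝ :=
  1 / ∏ i, (m.1 i : ℝ) ^ k i

/-- The multiple zeta value
`ζ(k_1, …, k_d) = ∑_{0 < m_1 < ⋯ < m_d} 1 / (m_1 ^ k_1 ⋯ m_d ^ k_d)`;
the series converges for admissible indices (`summable_term`). -/
noncomputable def zeta {d : ℕ} (k : Fin d → ℕ) : ℝ := ∑' m : Tuples d, term k m

/-- The set of all multiple zeta values of depth at most `n`, over all weights. It contains the
value `1` of depth `0`. -/
def valuesOfDepthLE (n : ℕ) : Set ℝ :=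
  {x | ∃ (e : ℕ) (l : Fin e → ℕ), e ≤ n ∧ Admissible l ∧ x = zeta l}

/-- The subring `ℚ[π²]` of `ℝ`. -/
noncomputable def ratPiSq : Subalgebra ℚ ℝ := Algebra.adjoin ℚ {Real.pi ^ 2}

theorem zeta_empty (k : Fin 0 → ℕ) : zeta k = 1 := by
  have : Unique (Tuples 0) :=
    { default := ⟨Fin.elim0, fun i => i.elim0, fun i => i.elim0⟩
      uniq := fun a => Subtype.ext (Subsingleton.elim _ _) }
  rw [zeta, tsum_eq_single default (fun b hb => absurd (Unique.eq_default b) hb)]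
  simp [term]

theorem summable_prod_pi (d : ℕ) (f : ℕ → ℝ) (h0 : ∀ n, 0 ≤ f n) (hf : Summable f) :
    Summable (fun m : Fin d → ℕ => ∏ i, f (m i)) := by
  induction d with
  | zero => exact Summable.of_finite
  | succ n ih =>
    have h := hf.mul_of_nonneg ih h0 (fun m => Finset.prod_nonneg fun i _ => h0 _)
    rw [← (Fin.consEquiv (fun _ : Fin (n + 1) => ℕ)).summable_iff]
    refine h.congr fun x => ?_
    simp [Fin.consEquiv, Fin.prod_univ_succ]

theorem summable_term {d : ℕ} (k : Fin d → ℕ) (hk : Admissible k) : Summable (term k) := by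
  rcases Nat.eq_zero_or_pos d with rfl | hd
  · exact Summable.of_finite
  obtain ⟨n, rfl⟩ : ∃ n, d = n + 1 := ⟨d - 1, by omega⟩
  set s : ℝ := 1 / (n + 1) with hs
  have hspos : 0 < s := by positivity
  have hf : Summable (fun a : ℕ => 1 / (a : ℝ) ^ (1 + s)) :=
    Real.summable_one_div_nat_rpow.2 (by linarith)
  have hp := (summable_prod_pi (n + 1) _ (fun a => by positivity) hf).comp_injective
    (Subtype.val_injective : Function.Injective (fun m : Tuples (n + 1) => m.1))
  refine Summable.of_nonneg_of_le (fun m => ?_) (fun m => ?_) hp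
  · unfold term; positivity
  · obtain ⟨m, hm, hmono⟩ := m
    have hm1 : ∀ i, (1 : ℝ) ≤ m i := fun i => by exact_mod_cast hm i
    have hm0 : ∀ i, (0 : ℝ) < m i := fun i => by exact_mod_cast hm i
    simp only [term, Function.comp, one_div, Finset.prod_inv_distrib]
    refine inv_anti₀ (Finset.prod_pos fun i _ => Real.rpow_pos_of_pos (hm0 i) _) ?_
    have hlast : ∏ i, (m i : ℝ) ^ s ≤ m (Fin.last n) := by
      calc ∏ i, (m i : ℝ) ^ s ≤ ∏ _i : Fin (n + 1), (m (Fin.last n) : ℝ) ^ s := by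
            refine Finset.prod_le_prod (fun i _ => by positivity) fun i _ => ?_
            refine Real.rpow_le_rpow (hm0 i).le ?_ hspos.le
            exact_mod_cast hmono.monotone (Fin.le_last i)
        _ = m (Fin.last n) := by
            rw [Finset.prod_const, Finset.card_univ, Fintype.card_fin, ← Real.rpow_natCast,
              ← Real.rpow_mul (hm0 _).le, hs]
            push_cast
            rw [one_div_mul_cancel (by positivity), Real.rpow_one]
    calc ∏ i, (m i : ℝ) ^ (1 + s) = (∏ i, (m i : ℝ)) * ∏ i, (m i : ℝ) ^ s := by
          rw [← Finset.prod_mul_distrib]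
          exact Finset.prod_congr rfl fun i _ => by rw [Real.rpow_add (hm0 i), Real.rpow_one]
      _ ≤ (∏ i, (m i : ℝ)) * m (Fin.last n) :=
          mul_le_mul_of_nonneg_left hlast (Finset.prod_nonneg fun i _ => (hm0 i).le)
      _ ≤ ∏ i, (m i : ℝ) ^ k i := by
          rw [Fin.prod_univ_castSucc, Fin.prod_univ_castSucc, mul_assoc]
          refine mul_le_mul ?_ ?_ (by positivity) (by positivity)
          · exact Finset.prod_le_prod (fun i _ => (hm0 _).le) fun i _ =>
              le_self_pow₀ (hm1 _) (by have := hk.1 i.castSucc; omega)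
          · rw [← pow_two]
            exact pow_le_pow_right₀ (hm1 _) (hk.2 (Fin.last n) (by simp))

end MZV

namespace MZVParity

/-- The sum of `∏ f n_i k_i` over integers `a < n_1 < ⋯ < n_d < b`. The word lists the second
arguments in the order `k_d, …, k_1`: its head belongs to the largest summation variable. -/
noncomputable def chain {R : Type*} [CommRing R] (f : ℤ → ℕ → R) : List ℕ → ℤ → ℤ → R
  | [], _, _ => 1
  | k :: w, a, b => ∑ m ∈ Finset.Ioo a b, f m k * chain f w a m

/-- The convolution of two functions on words, with respect to deconcatenation. -/
def conv {R : Type*} [CommRing R] (A B : List ℕ → R) (w : List ℕ) : R :=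
  ∑ i ∈ Finset.range (w.length + 1), A (w.take i) * B (w.drop i)

/-- The sum of `A v * g k * B u` over all decompositions of a word as `v ++ k :: u`. -/
def convLetter {R : Type*} [CommRing R] (A : List ℕ → R) (g : ℕ → R) (B : List ℕ → R)
    (w : List ℕ) : R :=
  ∑ i ∈ Finset.range w.length, A (w.take i) * g (w.getD i 0) * B (w.drop (i + 1))

section Algebra

variable {R : Type*} [CommRing R]

theorem conv_nil (A B : List ℕ → R) : conv A B [] = A [] * B [] := by simp [conv]

theorem conv_cons (A B : List ℕ → R) (k : ℕ) (w : List ℕ) :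
    conv A B (k :: w) = conv (fun v => A (k :: v)) B w + A [] * B (k :: w) := by
  simp [conv, Finset.sum_range_succ' _ (w.length + 1)]

theorem convLetter_cons (A : List ℕ → R) (g : ℕ → R) (B : List ℕ → R) (k : ℕ) (w : List ℕ) :
    convLetter A g B (k :: w) = convLetter (fun v => A (k :: v)) g B w + A [] * g k * B w := by
  simp [convLetter, Finset.sum_range_succ' _ w.length]

theorem conv_add_left (A A' B : List ℕ → R) (w : List ℕ) :
    conv (fun v => A v + A' v) B w = conv A B w + conv A' B w := by
  simp [conv, add_mul, Finset.sum_add_distrib]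

theorem conv_mul_left (c : R) (A B : List ℕ → R) (w : List ℕ) :
    conv (fun v => c * A v) B w = c * conv A B w := by
  simp [conv, Finset.mul_sum, mul_assoc]

theorem conv_assoc (A B C : List ℕ → R) (w : List ℕ) :
    conv (conv A B) C w = conv A (conv B C) w := by
  induction w generalizing A with
  | nil => simp [conv_nil, mul_assoc]
  | cons k w ih =>
    rw [conv_cons, conv_cons A]
    simp only [conv_cons, conv_add_left, conv_mul_left, conv_nil]
    rw [ih]
    ring

/-- The unit of the convolution product. -/
def convOne : List ℕ → R
  | [] => 1
  | _ :: _ => 0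

theorem conv_convOne (A : List ℕ → R) (w : List ℕ) : conv A convOne w = A w := by
  induction w generalizing A with
  | nil => simp [conv_nil, convOne]
  | cons k w ih => rw [conv_cons, ih]; simp [convOne]

theorem convOne_conv (A : List ℕ → R) (w : List ℕ) : conv convOne A w = A w := by
  cases w with
  | nil => simp [conv_nil, convOne]
  | cons k w => rw [conv_cons]; simp [convOne, conv]

theorem chain_nil (f : ℤ → ℕ → R) (a b : ℤ) : chain f [] a b = 1 := rfl

theorem chain_cons (f : ℤ → ℕ → R) (k : ℕ) (w : List ℕ) (a b : ℤ) :
    chain f (k :: w) a b = ∑ m ∈ Finset.Ioo a b, f m k * chain f w a m := rfl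

theorem chain_of_Ioo_eq_empty (f : ℤ → ℕ → R) (w : List ℕ) (a b : ℤ) (h : b ≤ a + 1) :
    chain f w a b = convOne w := by
  cases w with
  | nil => rfl
  | cons k w =>
    have : Finset.Ioo a b = ∅ := by
      ext x; simp only [Finset.mem_Ioo, Finset.notMem_empty, iff_false]; omega
    rw [chain_cons, this]; rfl

theorem chain_append_singleton (f : ℤ → ℕ → R) (w : List ℕ) (k : ℕ) (a b : ℤ) :
    chain f (w ++ [k]) a b = ∑ m ∈ Finset.Ioo a b, f m k * chain f w m b := by
  induction w generalizing b with
  | nil => simp [chain]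
  | cons l w ih =>
    simp only [List.cons_append, chain_cons, ih, Finset.mul_sum]
    rw [Finset.sum_comm' (t' := Finset.Ioo a b) (s' := fun n => Finset.Ioo n b)]
    · exact Finset.sum_congr rfl fun _ _ => Finset.sum_congr rfl fun _ _ => by ring
    · intro x y; simp only [Finset.mem_Ioo]; omega

theorem chain_neg (f : ℤ → ℕ → R) (w : List ℕ) (a b : ℤ) :
    chain (fun m k => f (-m) k) w a b = chain f w.reverse (-b) (-a) := by
  induction w generalizing b with
  | nil => rfl
  | cons k w ih =>
    rw [List.reverse_cons, chain_append_singleton, chain_cons]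
    refine Finset.sum_bij' (fun m _ => -m) (fun m _ => -m) ?_ ?_ ?_ ?_ ?_
    · intro m; simp only [Finset.mem_Ioo]; omega
    · intro m; simp only [Finset.mem_Ioo]; omega
    · simp
    · simp
    · intro m _; rw [ih]

theorem chain_shift (f : ℤ → ℕ → R) (c : ℤ) (w : List ℕ) (a b : ℤ) :
    chain (fun m k => f (m - c) k) w a b = chain f w (a - c) (b - c) := by
  induction w generalizing b with
  | nil => rfl
  | cons k w ih =>
    rw [chain_cons, chain_cons]
    refine Finset.sum_bij' (fun m _ => m - c) (fun m _ => m + c) ?_ ?_ ?_ ?_ ?_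
    · intro m; simp only [Finset.mem_Ioo]; omega
    · intro m; simp only [Finset.mem_Ioo]; omega
    · simp
    · simp
    · intro m _; rw [ih]

theorem chain_congr {f g : ℤ → ℕ → R} {a b : ℤ} (h : ∀ m ∈ Finset.Ioo a b, f m = g m)
    (w : List ℕ) : chain f w a b = chain g w a b := by
  induction w generalizing b with
  | nil => rfl
  | cons k w ih =>
    refine Finset.sum_congr rfl fun m hm => ?_
    rw [h m hm, ih]
    intro n hn
    apply h
    simp only [Finset.mem_Ioo] at *
    omega

theorem map_chain {S : Type*} [CommRing S] (φ : R →+* S) (f : ℤ → ℕ → R) (w : List ℕ)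
    (a b : ℤ) : φ (chain f w a b) = chain (fun m k => φ (f m k)) w a b := by
  induction w generalizing b with
  | nil => simp [chain]
  | cons k w ih => simp [chain, ih]

theorem sum_Ioo_split {M : Type*} [AddCommMonoid M] (g : ℤ → M) {a n b : ℤ} (h1 : a < n)
    (h2 : n < b) : ∑ m ∈ Finset.Ioo a b, g m =
      ∑ m ∈ Finset.Ioo n b, g m + g n + ∑ m ∈ Finset.Ioo a n, g m := by
  have : Finset.Ioo a b = Finset.Ioo n b ∪ {n} ∪ Finset.Ioo a n := by
    ext x; simp only [Finset.mem_Ioo, Finset.mem_union, Finset.mem_singleton]; omega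
  rw [this, Finset.sum_union, Finset.sum_union, Finset.sum_singleton]
  · rw [Finset.disjoint_left]; intro x; simp only [Finset.mem_Ioo, Finset.mem_singleton]; omega
  · rw [Finset.disjoint_left]; intro x
    simp only [Finset.mem_Ioo, Finset.mem_union, Finset.mem_singleton]; omega

/-- Splitting a chain sum at an interior point `n` of the range. -/
theorem chain_split (f : ℤ → ℕ → R) (w : List ℕ) {a n b : ℤ} (h1 : a < n) (h2 : n < b) :
    chain f w a b = conv (fun v => chain f v n b) (fun u => chain f u a n) w +
      convLetter (fun v => chain f v n b) (f n) (fun u => chain f u a n) w := by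
  induction w generalizing b with
  | nil => simp [conv, convLetter, chain]
  | cons k w ih =>
    rw [conv_cons, convLetter_cons, chain_cons, sum_Ioo_split _ h1 h2]
    have : ∑ m ∈ Finset.Ioo n b, f m k * chain f w a m =
        conv (fun v => chain f (k :: v) n b) (fun u => chain f u a n) w +
        convLetter (fun v => chain f (k :: v) n b) (f n) (fun u => chain f u a n) w := by
      rw [Finset.sum_congr rfl fun m hm => by rw [ih (Finset.mem_Ioo.1 hm).1]]
      simp only [conv, convLetter, chain_cons, Finset.sum_mul, Finset.mul_sum, mul_add,
        Finset.sum_add_distrib]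
      congr 1
      · rw [Finset.sum_comm]
        exact Finset.sum_congr rfl fun _ _ => Finset.sum_congr rfl fun _ _ => by ring
      · rw [Finset.sum_comm]
        exact Finset.sum_congr rfl fun _ _ => Finset.sum_congr rfl fun _ _ => by ring
    rw [this]
    simp only [chain_nil, one_mul, chain_cons f k w a n]
    ring

end Algebra

section Laurent

open HahnSeries

/-- The Laurent series `(X + a)⁻¹`. -/
noncomputable def invLin (a : ℤ) : LaurentSeries ℝ :=
  (single (1 : ℤ) (1 : ℝ) + HahnSeries.C (a : ℝ))⁻¹

theorem lin_ne_zero (a : ℤ) : (single (1 : ℤ) (1 : ℝ) + HahnSeries.C (a : ℝ)) ≠ 0 := by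
  intro h
  have := congrArg (fun y : LaurentSeries ℝ => y.coeff 1) h
  rw [HahnSeries.coeff_add, HahnSeries.coeff_single_same, HahnSeries.C_apply,
    HahnSeries.coeff_single_of_ne one_ne_zero] at this
  simp at this

theorem invLin_mul_invLin {a b : ℤ} (h : a ≠ b) :
    invLin a * invLin b = HahnSeries.C (((b : ℝ) - a)⁻¹) * (invLin a - invLin b) := by
  have h' : (b : ℝ) - a ≠ 0 := sub_ne_zero.2 (by exact_mod_cast h.symm)
  have h1 : HahnSeries.C (((b : ℝ) - a)⁻¹) *
      (HahnSeries.C (Γ := ℤ) (b : ℝ) - HahnSeries.C (a : ℝ)) = 1 := by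
    rw [← map_sub, ← map_mul, inv_mul_cancel₀ h', map_one]
  have ha := lin_ne_zero a
  have hb := lin_ne_zero b
  unfold invLin
  have : ((single (1 : ℤ) (1 : ℝ) + HahnSeries.C (a : ℝ))⁻¹ -
      (single (1 : ℤ) (1 : ℝ) + HahnSeries.C (b : ℝ))⁻¹) =
      (HahnSeries.C (Γ := ℤ) (b : ℝ) - HahnSeries.C (a : ℝ)) *
      ((single (1 : ℤ) (1 : ℝ) + HahnSeries.C (a : ℝ))⁻¹ *
      (single (1 : ℤ) (1 : ℝ) + HahnSeries.C (b : ℝ))⁻¹) := by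
    field_simp
    ring
  rw [this, ← mul_assoc, h1, one_mul]

/-- The power series `(X + a)⁻¹` for `a ≠ 0`. -/
noncomputable def invLinPS (a : ℤ) : PowerSeries ℝ :=
  PowerSeries.mk fun j => (-1) ^ j * ((a : ℝ) ^ (j + 1))⁻¹

theorem invLin_eq_ofPowerSeries {a : ℤ} (h : a ≠ 0) :
    invLin a = ofPowerSeries ℤ ℝ (invLinPS a) := by
  have ha : (a : ℝ) ≠ 0 := by exact_mod_cast h
  rw [invLin, inv_eq_iff_eq_inv]
  apply eq_inv_of_mul_eq_one_left
  rw [← HahnSeries.ofPowerSeries_X, ← HahnSeries.ofPowerSeries_C, ← map_add, ← map_mul]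
  rw [← map_one (ofPowerSeries ℤ ℝ)]
  congr 1
  ext j
  rw [add_mul, map_add, PowerSeries.coeff_C_mul]
  cases j with
  | zero => simp [invLinPS, ha]
  | succ j =>
    rw [PowerSeries.coeff_succ_X_mul, invLinPS, PowerSeries.coeff_mk, PowerSeries.coeff_mk,
      PowerSeries.coeff_one, if_neg (Nat.succ_ne_zero _)]
    field_simp
    ring

theorem invLin_zero_pow (k : ℕ) : invLin 0 ^ k = single (-(k : ℤ)) (1 : ℝ) := by
  have : invLin 0 = single (-1 : ℤ) (1 : ℝ) := by
    simp [invLin]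
  rw [this, HahnSeries.single_pow]
  simp

theorem coeff_neg_one_ofPowerSeries (p : PowerSeries ℝ) :
    (ofPowerSeries ℤ ℝ p).coeff (-1) = 0 := by
  have := PowerSeries.coeff_coe p (-1)
  simpa using this

theorem coeff_neg_one_invLin_zero_pow_mul (k : ℕ) (p : PowerSeries ℝ) :
    (invLin 0 ^ (k + 1) * ofPowerSeries ℤ ℝ p).coeff (-1) = PowerSeries.coeff k p := by
  rw [invLin_zero_pow]
  have := HahnSeries.coeff_single_mul_add (r := (1 : ℝ)) (x := ofPowerSeries ℤ ℝ p) (a := (k : ℤ))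
    (b := -((k + 1 : ℕ) : ℤ))
  rw [show (k : ℤ) + -((k + 1 : ℕ) : ℤ) = -1 by push_cast; ring] at this
  rw [this, one_mul, HahnSeries.ofPowerSeries_apply_coeff]

theorem coeff_neg_one_invLin_zero_pow (k : ℕ) (h : k ≠ 1) :
    (invLin 0 ^ k).coeff (-1) = 0 := by
  rw [invLin_zero_pow, HahnSeries.coeff_single_of_ne]
  omega

/-- The residues of `∏ (z + p)⁻¹` add up to zero if there are at least two factors. -/
theorem sum_residues_eq_zero (S : Finset ℤ) (n : ℕ) (s : Multiset ℤ) (hs : s.card = n + 2)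
    (hS : ∀ p ∈ s, p ∈ S) :
    ∑ n ∈ S, ((s.map fun p => invLin (p - n)).prod).coeff (-1) = 0 := by
  have single_residue : ∀ a ∈ S, ∑ n ∈ S, (invLin (a - n)).coeff (-1) = 1 := by
    intro a ha
    rw [Finset.sum_eq_single a]
    · have := coeff_neg_one_invLin_zero_pow_mul 0 1
      simpa using this
    · intro b _ hb
      rw [invLin_eq_ofPowerSeries (sub_ne_zero.2 hb.symm), coeff_neg_one_ofPowerSeries]
    · intro h; exact absurd ha h
  induction n generalizing s with
  | zero =>
    obtain ⟨a, b, rfl⟩ := Multiset.card_eq_two.1 hs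
    have ha := hS a (by simp)
    have hb := hS b (by simp)
    rcases eq_or_ne a b with rfl | hab
    · refine Finset.sum_eq_zero fun n _ => ?_
      simp only [Multiset.insert_eq_cons, Multiset.map_cons, Multiset.map_singleton,
        Multiset.prod_cons, Multiset.prod_singleton, ← pow_two]
      rcases eq_or_ne a n with rfl | h
      · rw [sub_self]; exact coeff_neg_one_invLin_zero_pow 2 (by norm_num)
      · rw [invLin_eq_ofPowerSeries (sub_ne_zero.2 h), ← map_pow, coeff_neg_one_ofPowerSeries]
    · simp only [Multiset.insert_eq_cons, Multiset.map_cons, Multiset.map_singleton,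
        Multiset.prod_cons, Multiset.prod_singleton]
      have : ∀ n : ℤ, (invLin (a - n) * invLin (b - n)).coeff (-1) =
          ((b : ℝ) - a)⁻¹ * ((invLin (a - n)).coeff (-1) - (invLin (b - n)).coeff (-1)) := by
        intro n
        rw [invLin_mul_invLin (by omega)]
        simp only [HahnSeries.C_mul_eq_smul, HahnSeries.coeff_smul, smul_eq_mul,
          HahnSeries.coeff_sub]
        push_cast
        ring_nf
      simp only [this]
      rw [← Finset.mul_sum, Finset.sum_sub_distrib, single_residue a ha, single_residue b hb]
      simp
  | succ n ih =>
    by_cases hall : ∃ a ∈ s, ∃ b ∈ s, a ≠ b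
    · obtain ⟨a, ha, b, hb, hab⟩ := hall
      obtain ⟨t, rfl⟩ := Multiset.exists_cons_of_mem ha
      have hb' : b ∈ t := (Multiset.mem_cons.1 hb).resolve_left hab.symm
      obtain ⟨t, rfl⟩ := Multiset.exists_cons_of_mem hb'
      have : ∀ n : ℤ, (((a ::ₘ b ::ₘ t).map fun p => invLin (p - n)).prod).coeff (-1) =
          ((b : ℝ) - a)⁻¹ * ((((a ::ₘ t).map fun p => invLin (p - n)).prod).coeff (-1) -
            (((b ::ₘ t).map fun p => invLin (p - n)).prod).coeff (-1)) := by
        intro n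
        simp only [Multiset.map_cons, Multiset.prod_cons]
        rw [← mul_assoc, invLin_mul_invLin (by omega), mul_assoc, sub_mul]
        simp only [HahnSeries.C_mul_eq_smul, HahnSeries.coeff_smul, smul_eq_mul,
          HahnSeries.coeff_sub]
        push_cast
        ring_nf
      simp only [this]
      rw [← Finset.mul_sum, Finset.sum_sub_distrib, ih, ih]
      · simp
      · simpa using hs
      · intro p hp; apply hS; simp only [Multiset.mem_cons] at *; tauto
      · simpa using hs
      · intro p hp; apply hS; simp only [Multiset.mem_cons] at *; tauto
    · push Not at hall
      obtain ⟨a, ha⟩ := Multiset.exists_mem_of_ne_zero (s := s) (by rintro rfl; simp at hs)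
      have hrep : s = Multiset.replicate (n + 3) a :=
        Multiset.eq_replicate.2 ⟨hs, fun b hb => (hall a ha b hb).symm⟩
      refine Finset.sum_eq_zero fun m _ => ?_
      rw [hrep, Multiset.map_replicate, Multiset.prod_replicate]
      rcases eq_or_ne a m with rfl | h
      · rw [sub_self]; exact coeff_neg_one_invLin_zero_pow _ (by omega)
      · rw [invLin_eq_ofPowerSeries (sub_ne_zero.2 h), ← map_pow, coeff_neg_one_ofPowerSeries]

/-- The residues of a chain sum of the functions `(z + m)⁻¹ ^ k`, times `∏ (z + p)⁻¹`. -/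
theorem sum_residues_chain (S : Finset ℤ) (w : List ℕ) (s : Multiset ℤ)
    (hs : 2 ≤ w.sum + s.card) (hS : ∀ p ∈ s, p ∈ S) (a b : ℤ) (hab : Finset.Ioo a b ⊆ S) :
    ∑ n ∈ S, (chain (fun m k => invLin (m - n) ^ k) w a b *
      (s.map fun p => invLin (p - n)).prod).coeff (-1) = 0 := by
  induction w generalizing b s with
  | nil =>
    simp only [chain_nil, one_mul]
    exact sum_residues_eq_zero S (s.card - 2) s (by simp at hs; omega) hS
  | cons k w ih =>
    simp only [chain_cons, Finset.sum_mul]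
    have hsum : ∀ (T : Finset ℤ) (g : ℤ → LaurentSeries ℝ),
        (∑ m ∈ T, g m).coeff (-1) = ∑ m ∈ T, (g m).coeff (-1) :=
      fun T g => map_sum (HahnSeries.coeff.addMonoidHom (-1 : ℤ)) g T
    simp only [hsum]
    rw [Finset.sum_comm]
    refine Finset.sum_eq_zero fun m hm => ?_
    have := ih (Multiset.replicate k m + s) (by simp at *; omega) ?_ m ?_
    · rw [← this]
      refine Finset.sum_congr rfl fun n _ => ?_
      simp only [Multiset.map_add, Multiset.map_replicate, Multiset.prod_add,
        Multiset.prod_replicate]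
      congr 1
      ring
    · intro p hp
      rcases Multiset.mem_add.1 hp with h | h
      · rw [Multiset.eq_of_mem_replicate h]; exact hab hm
      · exact hS p h
    · intro x hx
      apply hab
      simp only [Finset.mem_Ioo] at *
      omega

end Laurent

section Residues

open HahnSeries (ofPowerSeries)

/-- The function `m ↦ m ^ (-k)`. -/
noncomputable def powInv (m : ℤ) (k : ℕ) : ℝ := ((m : ℝ) ^ k)⁻¹

/-- The power series whose coefficients are built from the Taylor coefficients at `0` of
`∏ (z + n_i) ^ (-k_i)`, summed over chains in `(a, b)`. -/
noncomputable def chainPS (w : List ℕ) (a b : ℤ) : PowerSeries ℝ :=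
  chain (fun m k => invLinPS m ^ k) w a b

theorem exists_coeff_invLinPS_pow :
    ∃ β : ℕ → ℕ → ℚ, ∀ (m : ℤ) (k j : ℕ),
      PowerSeries.coeff j (invLinPS m ^ k) = (β k j : ℝ) * powInv m (k + j) := by
  have : ∀ k j : ℕ, ∃ β : ℚ, ∀ m : ℤ,
      PowerSeries.coeff j (invLinPS m ^ k) = (β : ℝ) * powInv m (k + j) := by
    intro k
    induction k with
    | zero =>
      intro j
      refine ⟨if j = 0 then 1 else 0, fun m => ?_⟩
      rw [pow_zero, PowerSeries.coeff_one]
      split_ifs with h <;> simp [h, powInv]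
    | succ k ih =>
      intro j
      choose β hβ using ih
      refine ⟨∑ p ∈ Finset.HasAntidiagonal.antidiagonal j, β p.1 * (-1) ^ p.2, fun m => ?_⟩
      rw [pow_succ, PowerSeries.coeff_mul, Rat.cast_sum, Finset.sum_mul]
      refine Finset.sum_congr rfl fun p hp => ?_
      rw [hβ, invLinPS, PowerSeries.coeff_mk, ← Finset.HasAntidiagonal.mem_antidiagonal.1 hp]
      simp only [powInv]
      rw [show k + 1 + (p.1 + p.2) = (k + p.1) + (p.2 + 1) by ring, pow_add _ (k + p.1), mul_inv]
      push_cast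
      ring
  choose β hβ using this
  exact ⟨β, fun m k j => hβ k j m⟩

/-- The chain sums of the words that dominate `w` entrywise. -/
def dominating (w : List ℕ) : Set (ℤ → ℤ → ℝ) :=
  {g | ∃ w', List.Forall₂ (· ≤ ·) w w' ∧ g = chain powInv w'}

/-- Prepending a letter, as a linear map on functions of intervals. -/
noncomputable def prependLetter (k : ℕ) : (ℤ → ℤ → ℝ) →ₗ[ℚ] (ℤ → ℤ → ℝ) where
  toFun g a b := ∑ m ∈ Finset.Ioo a b, powInv m k * g a m
  map_add' g h := by ext a b; simp [mul_add, Finset.sum_add_distrib]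
  map_smul' c g := by
    ext a b
    simp only [Pi.smul_apply, RingHom.id_apply, Finset.smul_sum, mul_smul_comm]

theorem coeff_chainPS_mem (w : List ℕ) (j : ℕ) :
    (fun a b => PowerSeries.coeff j (chainPS w a b)) ∈ Submodule.span ℚ (dominating w) := by
  obtain ⟨β, hβ⟩ := exists_coeff_invLinPS_pow
  induction w generalizing j with
  | nil =>
    have h1 : chain powInv [] ∈ Submodule.span ℚ (dominating []) :=
      Submodule.subset_span ⟨[], List.Forall₂.nil, rfl⟩
    convert Submodule.smul_mem _ (if j = 0 then (1 : ℚ) else 0) h1 using 1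
    ext a b
    rw [chainPS, chain_nil, PowerSeries.coeff_one, Pi.smul_apply, Pi.smul_apply, chain_nil]
    split_ifs <;> simp
  | cons k w ih =>
    have key : ∀ i, ∀ g ∈ Submodule.span ℚ (dominating w),
        prependLetter (k + i) g ∈ Submodule.span ℚ (dominating (k :: w)) := by
      intro i g hg
      have := Submodule.apply_mem_span_image_of_mem_span (prependLetter (k + i)) hg
      refine Submodule.span_mono ?_ this
      rintro _ ⟨_, ⟨w', hw', rfl⟩, rfl⟩
      exact ⟨(k + i) :: w', List.Forall₂.cons (by omega) hw', rfl⟩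
    have : (fun a b => PowerSeries.coeff j (chainPS (k :: w) a b)) =
        ∑ p ∈ Finset.HasAntidiagonal.antidiagonal j, β k p.1 •
          prependLetter (k + p.1) (fun a b => PowerSeries.coeff p.2 (chainPS w a b)) := by
      ext a b
      simp only [Finset.sum_apply, Pi.smul_apply]
      simp only [chainPS, chain_cons, map_sum, PowerSeries.coeff_mul, hβ, prependLetter,
        LinearMap.coe_mk, AddHom.coe_mk, Finset.smul_sum]
      rw [Finset.sum_comm]
      refine Finset.sum_congr rfl fun p _ => Finset.sum_congr rfl fun m _ => ?_
      rw [Rat.smul_def]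
      ring
    rw [this]
    exact Submodule.sum_mem _ fun p _ => Submodule.smul_mem _ _ (key _ _ (ih _))

/-- A word all of whose letters are positive and whose head, if any, is at least `2`. -/
def Adm (w : List ℕ) : Prop := (∀ x ∈ w, 1 ≤ x) ∧ ∀ x ∈ w.head?, 2 ≤ x

theorem forall₂_le_pos {w w' : List ℕ} (h : List.Forall₂ (· ≤ ·) w w') (hw : ∀ x ∈ w, 1 ≤ x) :
    ∀ x ∈ w', 1 ≤ x := by
  induction h with
  | nil => simp
  | cons h1 _ ih =>
    simp only [List.mem_cons, forall_eq_or_imp] at hw ⊢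
    exact ⟨hw.1.trans h1, ih hw.2⟩

theorem Adm.of_forall₂_le {w w' : List ℕ} (h : List.Forall₂ (· ≤ ·) w w') (hw : Adm w) :
    Adm w' := by
  refine ⟨forall₂_le_pos h hw.1, ?_⟩
  cases h with
  | nil => simp
  | cons h1 _ =>
    have := hw.2
    simp only [List.head?_cons, Option.mem_some_iff, forall_eq'] at this ⊢
    omega

theorem Adm.take {w : List ℕ} (hw : Adm w) (i : ℕ) : Adm (w.take i) := by
  refine ⟨fun x hx => hw.1 x (List.mem_of_mem_take hx), ?_⟩
  cases i with
  | zero => simp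
  | succ i =>
    cases w with
    | nil => simp
    | cons k w => simpa using hw.2

/-- The products of a chain sum over `(0, B)` and a chain sum over `(-A, 0)` of total depth `d`,
the first one being convergent. -/
def twoSided (d : ℕ) : Set (ℤ → ℤ → ℝ) :=
  {g | ∃ v u : List ℕ, v.length + u.length = d ∧ Adm v ∧ (∀ x ∈ u, 1 ≤ x) ∧
    g = fun A B => chain powInv v 0 B * chain powInv u (-A) 0}

/-- The coefficient of `X ^ c` in the product of the regular parts, at the left and the right of
the letter number `i`, of the Laurent expansion of a chain sum. -/
noncomputable def coefTerm (w : List ℕ) (i c : ℕ) (A B : ℤ) : ℝ :=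
  PowerSeries.coeff c (chainPS (w.take i) 0 B * chainPS (w.drop (i + 1)) (-A) 0)

theorem coefTerm_mem {w : List ℕ} (hw : Adm w) {i : ℕ} (hi : i < w.length) (c : ℕ) :
    coefTerm w i c ∈ Submodule.span ℚ (twoSided (w.length - 1)) := by
  let φ : (ℤ → ℤ → ℝ) →ₗ[ℚ] (ℤ → ℤ → ℝ) :=
    { toFun := fun g _ B => g 0 B, map_add' := fun _ _ => rfl, map_smul' := fun _ _ => rfl }
  let ψ : (ℤ → ℤ → ℝ) →ₗ[ℚ] (ℤ → ℤ → ℝ) :=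
    { toFun := fun g A _ => g (-A) 0, map_add' := fun _ _ => rfl, map_smul' := fun _ _ => rfl }
  have hle : Submodule.span ℚ (φ '' dominating (w.take i)) *
      Submodule.span ℚ (ψ '' dominating (w.drop (i + 1))) ≤
      Submodule.span ℚ (twoSided (w.length - 1)) := by
    rw [Submodule.span_mul_span]
    refine Submodule.span_mono ?_
    rintro _ ⟨_, ⟨_, ⟨v, hv, rfl⟩, rfl⟩, _, ⟨_, ⟨u, hu, rfl⟩, rfl⟩, rfl⟩
    refine ⟨v, u, ?_, (hw.take i).of_forall₂_le hv, ?_, rfl⟩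
    · rw [← hv.length_eq, ← hu.length_eq, List.length_take, List.length_drop]; omega
    · exact forall₂_le_pos hu fun x hx => hw.1 x (List.mem_of_mem_drop hx)
  have : coefTerm w i c = ∑ p ∈ Finset.HasAntidiagonal.antidiagonal c,
      φ (fun a b => PowerSeries.coeff p.1 (chainPS (w.take i) a b)) *
      ψ (fun a b => PowerSeries.coeff p.2 (chainPS (w.drop (i + 1)) a b)) := by
    ext A B
    simp only [Finset.sum_apply, Pi.mul_apply]
    simp only [coefTerm, PowerSeries.coeff_mul]
    rfl
  rw [this]
  refine Submodule.sum_mem _ fun p _ => hle (Submodule.mul_mem_mul ?_ ?_)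
  · exact Submodule.apply_mem_span_image_of_mem_span φ (coeff_chainPS_mem _ _)
  · exact Submodule.apply_mem_span_image_of_mem_span ψ (coeff_chainPS_mem _ _)

theorem chain_invLin_eq (w : List ℕ) {a b : ℤ} (h : (0 : ℤ) ∉ Finset.Ioo a b) :
    chain (fun m k => invLin m ^ k) w a b = ofPowerSeries ℤ ℝ (chainPS w a b) := by
  rw [chainPS, map_chain]
  refine chain_congr (fun m hm => ?_) w
  ext1 k
  rw [map_pow, invLin_eq_ofPowerSeries]
  rintro rfl
  exact h hm

theorem chain_invLin_split (w : List ℕ) {a b : ℤ} (ha : a < 0) (hb : 0 < b) :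
    chain (fun m k => invLin m ^ k) w a b =
      ofPowerSeries ℤ ℝ (conv (fun v => chainPS v 0 b) (fun u => chainPS u a 0) w) +
      ∑ i ∈ Finset.range w.length, invLin 0 ^ (w.getD i 0) *
        ofPowerSeries ℤ ℝ (chainPS (w.take i) 0 b * chainPS (w.drop (i + 1)) a 0) := by
  rw [chain_split _ w ha hb]
  simp only [conv, convLetter, map_sum, map_mul]
  congr 1
  · refine Finset.sum_congr rfl fun i _ => ?_
    rw [chain_invLin_eq _ (by simp), chain_invLin_eq _ (by simp)]
  · refine Finset.sum_congr rfl fun i _ => ?_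
    rw [chain_invLin_eq _ (by simp), chain_invLin_eq _ (by simp)]
    ring

theorem coeff_sum_neg_one (T : Finset ℕ) (g : ℕ → LaurentSeries ℝ) :
    (∑ m ∈ T, g m).coeff (-1) = ∑ m ∈ T, (g m).coeff (-1) :=
  map_sum (HahnSeries.coeff.addMonoidHom (-1 : ℤ)) g T

theorem getD_pos {w : List ℕ} (hw : ∀ x ∈ w, 1 ≤ x) {i : ℕ} (hi : i ∈ Finset.range w.length) :
    1 ≤ w.getD i 0 := by
  rw [List.getD_eq_getElem _ _ (Finset.mem_range.1 hi)]
  exact hw _ (List.getElem_mem _)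

theorem residue_mul_ofPowerSeries {w : List ℕ} (hw : ∀ x ∈ w, 1 ≤ x) {a b : ℤ} (ha : a < 0)
    (hb : 0 < b) (q : PowerSeries ℝ) :
    (chain (fun m k => invLin m ^ k) w a b * ofPowerSeries ℤ ℝ q).coeff (-1) =
      ∑ i ∈ Finset.range w.length, ∑ j ∈ Finset.range (w.getD i 0),
        PowerSeries.coeff j q * coefTerm w i (w.getD i 0 - 1 - j) (-a) b := by
  rw [chain_invLin_split w ha hb, add_mul, ← map_mul, HahnSeries.coeff_add,
    coeff_neg_one_ofPowerSeries, zero_add, Finset.sum_mul, coeff_sum_neg_one]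
  refine Finset.sum_congr rfl fun i hi => ?_
  obtain ⟨k, hk⟩ : ∃ k, w.getD i 0 = k + 1 := ⟨w.getD i 0 - 1, by have := getD_pos hw hi; omega⟩
  rw [mul_assoc, ← map_mul, hk, coeff_neg_one_invLin_zero_pow_mul, mul_comm,
    PowerSeries.coeff_mul, Finset.Nat.sum_antidiagonal_eq_sum_range_succ_mk]
  simp only [coefTerm, neg_neg, Nat.add_sub_cancel]

theorem residue_mul_invLin_zero (w : List ℕ) {a b : ℤ} (ha : a < 0) (hb : 0 < b) :
    (chain (fun m k => invLin m ^ k) w a b * invLin 0).coeff (-1) =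
      conv (fun v => chain powInv v 0 b) (fun u => chain powInv u a 0) w +
      ∑ i ∈ Finset.range w.length, coefTerm w i (w.getD i 0) (-a) b := by
  have h0 : ∀ v a b, PowerSeries.constantCoeff (chainPS v a b) = chain powInv v a b := by
    intro v a b
    rw [chainPS, map_chain]
    refine chain_congr (fun m _ => ?_) v
    ext k
    rw [map_pow, ← PowerSeries.coeff_zero_eq_constantCoeff_apply, invLinPS, PowerSeries.coeff_mk]
    simp [powInv]
  rw [chain_invLin_split w ha hb, add_mul, HahnSeries.coeff_add, Finset.sum_mul, coeff_sum_neg_one]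
  congr 1
  · have := coeff_neg_one_invLin_zero_pow_mul 0
      (conv (fun v => chainPS v 0 b) (fun u => chainPS u a 0) w)
    rw [mul_comm]
    rw [zero_add, pow_one] at this
    rw [this, PowerSeries.coeff_zero_eq_constantCoeff_apply]
    simp only [conv, map_sum, map_mul, h0]
  · refine Finset.sum_congr rfl fun i _ => ?_
    rw [mul_right_comm, ← pow_succ, coeff_neg_one_invLin_zero_pow_mul, coefTerm, neg_neg]

theorem chain_invLin_sub (w : List ℕ) (N n : ℤ) :
    chain (fun m k => invLin (m - n) ^ k) w (-N) N =
      chain (fun m k => invLin m ^ k) w (-(N + n)) (N - n) := by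
  rw [chain_shift (fun m k => invLin m ^ k), neg_add, sub_eq_add_neg (-N)]

/-- The residues of a chain sum add up to zero. -/
theorem sum_coefTerm_eq_zero {w : List ℕ} (hw : ∀ x ∈ w, 1 ≤ x) (hw2 : 2 ≤ w.sum) (N : ℤ) :
    ∑ n ∈ Finset.Ioo (-N) N, ∑ i ∈ Finset.range w.length,
      coefTerm w i (w.getD i 0 - 1) (N + n) (N - n) = 0 := by
  rw [← sum_residues_chain (Finset.Ioo (-N) N) w 0 (by simpa using hw2) (by simp) (-N) N
    (Finset.Subset.refl _)]
  refine Finset.sum_congr rfl fun n hn => ?_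
  have hn := Finset.mem_Ioo.1 hn
  rw [Multiset.map_zero, Multiset.prod_zero, ← map_one (ofPowerSeries ℤ ℝ), chain_invLin_sub,
    residue_mul_ofPowerSeries hw (by omega) (by omega)]
  refine Finset.sum_congr rfl fun i hi => ?_
  rw [Finset.sum_eq_single_of_mem 0]
  · simp
  · exact Finset.mem_range.2 (getD_pos hw hi)
  · intro j _ hj
    rw [PowerSeries.coeff_one, if_neg hj, zero_mul]

/-- The constant term at `0` of a chain sum, expressed by its principal parts at the other poles. -/
theorem conv_eq_sum_coefTerm {w : List ℕ} (hw : ∀ x ∈ w, 1 ≤ x) (hw1 : 1 ≤ w.sum) {N : ℤ}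
    (hN : 0 < N) :
    conv (fun v => chain powInv v 0 N) (fun u => chain powInv u (-N) 0) w =
      ∑ n ∈ (Finset.Ioo (-N) N).erase 0, ∑ i ∈ Finset.range w.length,
        ∑ j ∈ Finset.range (w.getD i 0),
          powInv n (j + 1) * coefTerm w i (w.getD i 0 - 1 - j) (N + n) (N - n)
      - ∑ i ∈ Finset.range w.length, coefTerm w i (w.getD i 0) N N := by
  have h := sum_residues_chain (Finset.Ioo (-N) N) w {0} (by simpa using hw1)
    (by simp [hN]) (-N) N (Finset.Subset.refl _)
  rw [← Finset.add_sum_erase _ _ (show (0 : ℤ) ∈ Finset.Ioo (-N) N by simp [hN])] at h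
  simp only [Multiset.map_singleton, Multiset.prod_singleton] at h
  rw [chain_invLin_sub, sub_zero, sub_zero, add_zero,
    residue_mul_invLin_zero w (by omega) hN, neg_neg] at h
  have h2 : ∀ n ∈ (Finset.Ioo (-N) N).erase 0,
      (chain (fun m k => invLin (m - n) ^ k) w (-N) N * invLin (0 - n)).coeff (-1) =
      -∑ i ∈ Finset.range w.length, ∑ j ∈ Finset.range (w.getD i 0),
          powInv n (j + 1) * coefTerm w i (w.getD i 0 - 1 - j) (N + n) (N - n) := by
    intro n hn
    simp only [Finset.mem_erase, Finset.mem_Ioo] at hn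
    rw [chain_invLin_sub, invLin_eq_ofPowerSeries (by omega),
      residue_mul_ofPowerSeries hw (by omega) (by omega), neg_neg]
    simp only [← Finset.sum_neg_distrib]
    refine Finset.sum_congr rfl fun i _ => Finset.sum_congr rfl fun j _ => ?_
    rw [← neg_mul, invLinPS, PowerSeries.coeff_mk, powInv]
    congr 1
    push_cast
    rw [zero_sub, neg_pow (n : ℝ), mul_inv, pow_succ (-1 : ℝ), ← mul_assoc]
    rcases neg_one_pow_eq_or ℝ j with h | h <;> rw [h] <;> norm_num
  rw [Finset.sum_congr rfl h2, Finset.sum_neg_distrib] at h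
  linarith

end Residues

/-- The truncated multiple zeta value, a sum over `0 < m_1 < ⋯ < m_d < N`. -/
noncomputable def mhs (w : List ℕ) (N : ℕ) : ℝ := chain powInv w 0 N

theorem mhs_nil (N : ℕ) : mhs [] N = 1 := rfl

theorem sum_Ioo_zero_natCast {M : Type*} [AddCommMonoid M] (g : ℤ → M) (N : ℕ) :
    ∑ m ∈ Finset.Ioo (0 : ℤ) N, g m = ∑ m ∈ Finset.Ico 1 N, g m := by
  refine (Finset.sum_nbij (fun m : ℕ => (m : ℤ)) ?_ ?_ ?_ ?_).symm
  · intro m; simp only [Finset.mem_Ico, Finset.mem_Ioo]; omega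
  · intro a _ b _ h; simpa using h
  · intro m hm
    simp only [Finset.coe_Ioo, Set.mem_Ioo] at hm
    exact ⟨m.toNat, by simp only [Finset.coe_Ico, Set.mem_Ico]; omega, by dsimp only; omega⟩
  · simp

theorem mhs_cons (k : ℕ) (w : List ℕ) (N : ℕ) :
    mhs (k :: w) N = ∑ m ∈ Finset.Ico 1 N, ((m : ℝ) ^ k)⁻¹ * mhs w m := by
  rw [mhs, chain_cons, sum_Ioo_zero_natCast]
  simp [powInv, mhs]

theorem mhs_cons_succ (k : ℕ) (w : List ℕ) {N : ℕ} (hN : 1 ≤ N) :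
    mhs (k :: w) (N + 1) = mhs (k :: w) N + ((N : ℝ) ^ k)⁻¹ * mhs w N := by
  rw [mhs_cons, mhs_cons, Finset.sum_Ico_succ_top hN]

theorem chain_neg_zero (u : List ℕ) (A : ℕ) :
    chain powInv u (-A) 0 = (-1) ^ u.sum * mhs u.reverse A := by
  have h : ∀ (w : List ℕ) (b : ℤ), chain (fun m k => powInv (-m) k) w 0 b =
      (-1) ^ w.sum * chain powInv w 0 b := by
    intro w
    induction w with
    | nil => simp [chain]
    | cons k w ih =>
      intro b
      rw [chain_cons, chain_cons, Finset.mul_sum]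
      refine Finset.sum_congr rfl fun m _ => ?_
      have : powInv (-m) k = (-1) ^ k * powInv m k := by
        simp only [powInv]
        push_cast
        rw [neg_pow, mul_inv]
        rcases neg_one_pow_eq_or ℝ k with h | h <;> rw [h] <;> norm_num
      rw [ih, this, List.sum_cons, pow_add]
      ring
  have h2 := chain_neg powInv u.reverse 0 A
  rw [List.reverse_reverse, neg_zero] at h2
  rw [← h2, h, List.sum_reverse, mhs]

/-- The quasi-shuffles of two words. -/
def stuffle : List ℕ → List ℕ → List (List ℕ)
  | [], v => [v]
  | k :: u, [] => [k :: u]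
  | k :: u, l :: v => (stuffle u (l :: v)).map (k :: ·) ++ (stuffle (k :: u) v).map (l :: ·) ++
      (stuffle u v).map ((k + l) :: ·)
  termination_by u v => u.length + v.length

theorem sum_mul_sum_Ico (a b : ℕ → ℝ) (N : ℕ) :
    (∑ m ∈ Finset.Ico 1 N, a m) * ∑ m ∈ Finset.Ico 1 N, b m =
      ∑ m ∈ Finset.Ico 1 N, a m * (∑ n ∈ Finset.Ico 1 m, b n) +
      ∑ m ∈ Finset.Ico 1 N, b m * (∑ n ∈ Finset.Ico 1 m, a n) +
      ∑ m ∈ Finset.Ico 1 N, a m * b m := by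
  induction N with
  | zero => simp
  | succ N ih =>
    rcases Nat.eq_zero_or_pos N with rfl | hN
    · simp
    · simp only [Finset.sum_Ico_succ_top (show 1 ≤ N from hN)]
      linear_combination ih

theorem sum_map_mhs_cons (k : ℕ) (T : List (List ℕ)) (N : ℕ) :
    ((T.map (k :: ·)).map (mhs · N)).sum =
      ∑ m ∈ Finset.Ico 1 N, ((m : ℝ) ^ k)⁻¹ * (T.map (mhs · m)).sum := by
  induction T with
  | nil => simp
  | cons c T ih => simp [mul_add, Finset.sum_add_distrib, ← mhs_cons, ← ih]

theorem mhs_cons_mul_cons (k : ℕ) (u : List ℕ) (l : ℕ) (v : List ℕ) (N : ℕ) :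
    mhs (k :: u) N * mhs (l :: v) N =
      ∑ m ∈ Finset.Ico 1 N, ((m : ℝ) ^ k)⁻¹ * (mhs u m * mhs (l :: v) m) +
      ∑ m ∈ Finset.Ico 1 N, ((m : ℝ) ^ l)⁻¹ * (mhs (k :: u) m * mhs v m) +
      ∑ m ∈ Finset.Ico 1 N, ((m : ℝ) ^ (k + l))⁻¹ * (mhs u m * mhs v m) := by
  rw [mhs_cons, mhs_cons, sum_mul_sum_Ico]
  simp only [← mhs_cons]
  congr 1
  · congr 1 <;> exact Finset.sum_congr rfl fun m _ => by ring
  · refine Finset.sum_congr rfl fun m _ => ?_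
    rw [pow_add, mul_inv]
    ring

theorem mhs_mul (u v : List ℕ) (N : ℕ) :
    mhs u N * mhs v N = ((stuffle u v).map (mhs · N)).sum := by
  induction u, v using stuffle.induct generalizing N with
  | case1 v => simp [stuffle, mhs_nil]
  | case2 k u => simp [stuffle, mhs_nil]
  | case3 k u l v ih1 ih2 ih3 =>
    rw [stuffle, mhs_cons_mul_cons]
    simp only [ih1, ih2, ih3, ← sum_map_mhs_cons, List.map_append, List.sum_append]

theorem length_le_of_mem_stuffle {u v c : List ℕ} (hc : c ∈ stuffle u v) :
    c.length ≤ u.length + v.length := by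
  induction u, v using stuffle.induct generalizing c with
  | case1 v => simp [stuffle] at hc; simp [hc]
  | case2 k u => simp [stuffle] at hc; simp [hc]
  | case3 k u l v ih1 ih2 ih3 =>
    simp only [stuffle, List.mem_append, List.mem_map] at hc
    obtain (⟨c, h, rfl⟩ | ⟨c, h, rfl⟩) | ⟨c, h, rfl⟩ := hc
    · have := ih1 h; simp at *; omega
    · have := ih2 h; simp at *; omega
    · have := ih3 h; simp at *; omega

theorem adm_cons {k : ℕ} {w : List ℕ} : Adm (k :: w) ↔ 2 ≤ k ∧ ∀ x ∈ w, 1 ≤ x := by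
  simp only [Adm, List.mem_cons, forall_eq_or_imp, List.head?_cons, Option.mem_some_iff,
    forall_eq']
  exact ⟨fun h => ⟨h.2, h.1.2⟩, fun h => ⟨⟨by omega, h.2⟩, h.1⟩⟩

theorem adm_nil : Adm [] := by simp [Adm]

theorem pos_of_mem_stuffle {u v c : List ℕ} (hu : ∀ x ∈ u, 1 ≤ x) (hv : ∀ x ∈ v, 1 ≤ x)
    (hc : c ∈ stuffle u v) : ∀ x ∈ c, 1 ≤ x := by
  induction u, v using stuffle.induct generalizing c with
  | case1 v => simp [stuffle] at hc; rwa [hc]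
  | case2 k u => simp [stuffle] at hc; rwa [hc]
  | case3 k u l v ih1 ih2 ih3 =>
    simp only [stuffle, List.mem_append, List.mem_map] at hc
    have hu' := List.forall_mem_cons.1 hu
    have hv' := List.forall_mem_cons.1 hv
    obtain (⟨c, h, rfl⟩ | ⟨c, h, rfl⟩) | ⟨c, h, rfl⟩ := hc
    · exact List.forall_mem_cons.2 ⟨hu'.1, ih1 hu'.2 hv h⟩
    · exact List.forall_mem_cons.2 ⟨hv'.1, ih2 hu hv'.2 h⟩
    · exact List.forall_mem_cons.2 ⟨by omega, ih3 hu'.2 hv'.2 h⟩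

theorem adm_of_mem_stuffle {u v c : List ℕ} (hu : Adm u) (hv : Adm v) (hc : c ∈ stuffle u v) :
    Adm c := by
  refine ⟨pos_of_mem_stuffle hu.1 hv.1 hc, ?_⟩
  match u, v with
  | [], v => simp [stuffle] at hc; rw [hc]; exact hv.2
  | k :: u, [] => simp [stuffle] at hc; rw [hc]; exact hu.2
  | k :: u, l :: v =>
    have hu := (adm_cons.1 hu).1
    have hv := (adm_cons.1 hv).1
    simp only [stuffle, List.mem_append, List.mem_map] at hc
    obtain (⟨c, h, rfl⟩ | ⟨c, h, rfl⟩) | ⟨c, h, rfl⟩ := hc <;>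
    · simp only [List.head?_cons, Option.mem_some_iff, forall_eq']
      omega

/-- The product of the harmonic number and a truncated multiple zeta value with `s` divergent
letters at its head. -/
theorem exists_harmonic_mul_mhs (s : ℕ) {v : List ℕ} (hv : Adm v) :
    ∃ T : List (List ℕ), (∀ c ∈ T, ∃ i x, c = List.replicate i 1 ++ x ∧ i ≤ s ∧ Adm x ∧
        i + x.length ≤ s + 1 + v.length) ∧
      ∀ N, mhs [1] N * mhs (List.replicate s 1 ++ v) N =
        (s + 1) * mhs (List.replicate (s + 1) 1 ++ v) N + (T.map (mhs · N)).sum := by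
  induction s with
  | zero =>
    cases v with
    | nil => exact ⟨[], by simp, by simp [mhs_nil]⟩
    | cons k v =>
      refine ⟨(stuffle [1] v).map (k :: ·) ++ [(k + 1) :: v], ?_, ?_⟩
      · intro c hc
        have hv := adm_cons.1 hv
        refine ⟨0, c, rfl, le_rfl, ?_, ?_⟩ <;>
        · simp only [List.mem_append, List.mem_map, List.mem_singleton] at hc
          obtain ⟨c, h, rfl⟩ | rfl := hc
          · first
            | exact adm_cons.2 ⟨hv.1, pos_of_mem_stuffle (by simp) hv.2 h⟩
            | (have := length_le_of_mem_stuffle h; simp at *; omega)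
          · first
            | exact adm_cons.2 ⟨by omega, hv.2⟩
            | simp
      · intro N
        rw [List.replicate_zero, List.nil_append, mhs_cons_mul_cons]
        simp only [mhs_mul [1] v, ← sum_map_mhs_cons, List.map_append, List.sum_append,
          List.map_singleton, List.sum_singleton, mhs_nil, one_mul, ← mhs_cons, add_comm 1 k]
        simp only [Nat.cast_zero, zero_add, one_mul, List.replicate_one, List.singleton_append]
        ring
  | succ s ih =>
    obtain ⟨T, hT, h⟩ := ih
    refine ⟨T.map (1 :: ·) ++ [2 :: (List.replicate s 1 ++ v)], ?_, ?_⟩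
    · intro c hc
      simp only [List.mem_append, List.mem_map, List.mem_singleton] at hc
      obtain ⟨c, hc, rfl⟩ | rfl := hc
      · obtain ⟨i, x, rfl, hi, hx, hl⟩ := hT c hc
        exact ⟨i + 1, x, rfl, by omega, hx, by omega⟩
      · refine ⟨0, _, rfl, by omega, adm_cons.2 ⟨le_rfl, ?_⟩, ?_⟩
        · intro x hx
          rcases List.mem_append.1 hx with h | h
          · rw [List.eq_of_mem_replicate h]
          · exact hv.1 x h
        · simp
    · intro N
      rw [List.replicate_succ, List.cons_append, mhs_cons_mul_cons]
      simp only [h, mhs_nil, one_mul, ← mhs_cons, List.map_append, List.sum_append,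
        sum_map_mhs_cons, List.map_singleton, List.sum_singleton, mul_add,
        Finset.sum_add_distrib]
      have : ∑ m ∈ Finset.Ico 1 N, ((m : ℝ) ^ 1)⁻¹ *
          (((s : ℝ) + 1) * mhs (List.replicate (s + 1) 1 ++ v) m) =
          (s + 1) * mhs (1 :: (List.replicate (s + 1) 1 ++ v)) N := by
        rw [mhs_cons, Finset.mul_sum]
        exact Finset.sum_congr rfl fun _ _ => by ring
      rw [this]
      simp only [List.replicate_succ, List.cons_append]
      push_cast
      ring

/-- The truncated multiple zeta star value, a sum over `0 < m_1 ≤ ⋯ ≤ m_d < N`. -/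
noncomputable def starSum : List ℕ → ℕ → ℝ
  | [], _ => 1
  | k :: w, N => ∑ m ∈ Finset.Ico 1 N, ((m : ℝ) ^ k)⁻¹ * starSum w (m + 1)

/-- The word obtained by merging a letter with the head of a word. -/
def merge (k : ℕ) : List ℕ → List (List ℕ)
  | [] => []
  | l :: c => [(k + l) :: c]

theorem sum_mhs_succ (k : ℕ) (c : List ℕ) (N : ℕ) :
    ∑ m ∈ Finset.Ico 1 N, ((m : ℝ) ^ k)⁻¹ * mhs c (m + 1) =
      mhs (k :: c) N + ((merge k c).map (mhs · N)).sum := by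
  cases c with
  | nil => simp [merge, mhs_cons, mhs_nil]
  | cons l c =>
    simp only [merge, List.map_singleton, List.sum_singleton]
    rw [mhs_cons, mhs_cons, ← Finset.sum_add_distrib]
    refine Finset.sum_congr rfl fun m hm => ?_
    rw [mhs_cons_succ _ _ (Finset.mem_Ico.1 hm).1, pow_add, mul_inv]
    ring

theorem exists_starSum_eq (w : List ℕ) :
    ∃ T : List (List ℕ), (∀ c ∈ T, c.length < w.length ∧ ((∀ x ∈ w, 1 ≤ x) → ∀ x ∈ c, 1 ≤ x) ∧
        (Adm w → Adm c)) ∧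
      ∀ N, starSum w N = mhs w N + (T.map (mhs · N)).sum := by
  induction w with
  | nil => exact ⟨[], by simp, by simp [starSum, mhs_nil]⟩
  | cons k w ih =>
    obtain ⟨T, hT, h⟩ := ih
    have hmerge : ∀ c d : List ℕ, d ∈ merge k c → d.length = c.length ∧
        ((1 ≤ k ∧ ∀ x ∈ c, 1 ≤ x) → ∀ x ∈ d, 1 ≤ x) ∧ (2 ≤ k → (∀ x ∈ c, 1 ≤ x) → Adm d) := by
      intro c d hd
      cases c with
      | nil => simp [merge] at hd
      | cons l c =>
        simp only [merge, List.mem_singleton] at hd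
        subst hd
        refine ⟨by simp, fun hh => ?_, fun hk hh => ?_⟩
        · exact List.forall_mem_cons.2 ⟨by omega, (List.forall_mem_cons.1 hh.2).2⟩
        · exact adm_cons.2 ⟨by omega, (List.forall_mem_cons.1 hh).2⟩
    refine ⟨merge k w ++ T.flatMap (fun c => (k :: c) :: merge k c), ?_, ?_⟩
    · intro c hc
      simp only [List.mem_append, List.mem_flatMap, List.mem_cons] at hc
      obtain hc | ⟨c', hc', rfl | hc⟩ := hc
      · obtain ⟨h1, h2, h3⟩ := hmerge _ _ hc
        refine ⟨by simp; omega, fun hh => h2 (List.forall_mem_cons.1 hh), fun hh => ?_⟩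
        exact h3 (adm_cons.1 hh).1 (adm_cons.1 hh).2
      · obtain ⟨h1, h2, h3⟩ := hT _ hc'
        refine ⟨by simp; omega, fun hh => ?_, fun hh => ?_⟩
        · have := List.forall_mem_cons.1 hh
          exact List.forall_mem_cons.2 ⟨this.1, h2 this.2⟩
        · have := adm_cons.1 hh
          exact adm_cons.2 ⟨this.1, h2 this.2⟩
      · obtain ⟨h1, h2, h3⟩ := hT _ hc'
        obtain ⟨h4, h5, h6⟩ := hmerge _ _ hc
        refine ⟨by simp; omega, fun hh => ?_, fun hh => ?_⟩
        · have := List.forall_mem_cons.1 hh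
          exact h5 ⟨this.1, h2 this.2⟩
        · have := adm_cons.1 hh
          exact h6 this.1 (h2 this.2)
    · intro N
      simp only [starSum, h, mul_add, Finset.sum_add_distrib, sum_mhs_succ, List.map_append,
        List.sum_append, add_assoc]
      congr 2
      clear hT h
      induction T with
      | nil => simp
      | cons c T ih =>
        simp only [List.map_cons, List.sum_cons, mul_add, Finset.sum_add_distrib, sum_mhs_succ,
          ih, List.flatMap_cons, List.map_append, List.sum_append]

/-- The inverse, for the convolution product, of the chain sums over negative integers. -/
noncomputable def negInv (N : ℕ) (u : List ℕ) : ℝ := (-1) ^ (u.length + u.sum) * starSum u N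

/-- The function on words of length at most one that is given by `g` on letters. -/
def letters (g : ℕ → ℝ) : List ℕ → ℝ
  | [] => 1
  | k :: v => g k * convOne v

theorem conv_letters (A : List ℕ → ℝ) (g : ℕ → ℝ) (w : List ℕ) :
    conv A (letters g) w = A w + convLetter A g convOne w := by
  induction w generalizing A with
  | nil => simp [conv, convLetter, letters]
  | cons k w ih =>
    rw [conv_cons, ih, convLetter_cons, letters]
    ring

theorem letters_conv_negInv {N : ℕ} (hN : 1 ≤ N) (w : List ℕ) :
    conv (letters (powInv (-N))) (negInv (N + 1)) w = negInv N w := by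
  cases w with
  | nil => simp [conv, letters, negInv, starSum]
  | cons k w =>
    rw [conv_cons]
    simp only [letters]
    rw [conv_mul_left, convOne_conv]
    simp only [negInv, starSum, Finset.sum_Ico_succ_top hN, powInv, List.length_cons,
      List.sum_cons]
    push_cast
    rw [neg_pow, mul_inv, pow_add _ (w.length + 1), pow_add _ _ 1, pow_add _ k,
      pow_add _ w.length]
    rcases neg_one_pow_eq_or ℝ k with h | h <;> rw [h] <;> norm_num <;> ring

theorem conv_negInv {N : ℕ} (hN : 1 ≤ N) (w : List ℕ) :
    conv (fun u => chain powInv u (-N) 0) (negInv N) w = convOne w := by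
  induction N, hN using Nat.le_induction generalizing w with
  | base =>
    have : (fun u => chain powInv u (-(1 : ℕ)) 0) = convOne := by
      ext u
      exact chain_of_Ioo_eq_empty _ _ _ _ (by norm_num)
    rw [this, convOne_conv]
    cases w <;> simp [negInv, starSum, convOne]
  | succ N hN ih =>
    have : (fun u => chain powInv u (-(N + 1 : ℕ)) 0) =
        conv (fun u => chain powInv u (-N) 0) (letters (powInv (-N))) := by
      ext u
      rw [conv_letters, chain_split (n := -N) _ u (by push_cast; omega) (by omega)]
      have he : (fun u => chain powInv u (-(N + 1 : ℕ)) (-N)) = convOne := by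
        ext u
        exact chain_of_Ioo_eq_empty _ _ _ _ (by push_cast; omega)
      rw [he, conv_convOne]
    rw [this, conv_assoc]
    rw [← ih w]
    congr 1
    ext u
    exact letters_conv_negInv hN u

/-- Chain sums over positive integers in terms of those over nonzero integers. -/
theorem mhs_eq_conv {N : ℕ} (hN : 1 ≤ N) (w : List ℕ) :
    mhs w N = conv (conv (mhs · N) (fun u => chain powInv u (-N) 0)) (negInv N) w := by
  rw [conv_assoc]
  have : conv (fun u => chain powInv u (-N) 0) (negInv N) = convOne := by
    ext u; exact conv_negInv hN u
  rw [this, conv_convOne]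

section Growth

open Filter Topology

/-- One plus the harmonic number `∑_{0 < m < N} 1 / m`. -/
noncomputable def ell (N : ℕ) : ℝ := 1 + mhs [1] N

theorem mhs_one (N : ℕ) : mhs [1] N = ∑ m ∈ Finset.Ico 1 N, (m : ℝ)⁻¹ := by
  simp [mhs_cons, mhs_nil]

theorem mhs_nonneg (w : List ℕ) (N : ℕ) : 0 ≤ mhs w N := by
  induction w generalizing N with
  | nil => simp [mhs_nil]
  | cons k w ih =>
    rw [mhs_cons]
    exact Finset.sum_nonneg fun m _ => mul_nonneg (by positivity) (ih m)

theorem mhs_mono (w : List ℕ) {M N : ℕ} (h : M ≤ N) : mhs w M ≤ mhs w N := by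
  cases w with
  | nil => simp [mhs_nil]
  | cons k w =>
    rw [mhs_cons, mhs_cons]
    refine Finset.sum_le_sum_of_subset_of_nonneg (Finset.Ico_subset_Ico_right h) fun m _ _ => ?_
    exact mul_nonneg (by positivity) (mhs_nonneg w m)

theorem one_le_ell (N : ℕ) : 1 ≤ ell N := by
  have := mhs_nonneg [1] N
  unfold ell
  linarith

theorem ell_mono {M N : ℕ} (h : M ≤ N) : ell M ≤ ell N := by
  have := mhs_mono [1] h
  unfold ell
  linarith

theorem ell_two_mul_le (N : ℕ) : ell (2 * N) ≤ 2 * ell N := by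
  rcases Nat.eq_zero_or_pos N with rfl | hN
  · have := one_le_ell 0
    simp only [mul_zero]
    linarith
  have h : mhs [1] (2 * N) ≤ mhs [1] N + 1 := by
    rw [mhs_one, mhs_one, ← Finset.sum_Ico_consecutive _ (show 1 ≤ N from hN)
      (show N ≤ 2 * N by omega)]
    gcongr
    calc ∑ m ∈ Finset.Ico N (2 * N), (m : ℝ)⁻¹ ≤ ∑ m ∈ Finset.Ico N (2 * N), (N : ℝ)⁻¹ := by
          refine Finset.sum_le_sum fun m hm => ?_
          have := (Finset.mem_Ico.1 hm).1
          gcongr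
      _ = 1 := by
          rw [Finset.sum_const, Nat.card_Ico, nsmul_eq_mul, show 2 * N - N = N by omega,
            mul_inv_cancel₀ (by positivity)]
  have := mhs_nonneg [1] N
  unfold ell
  linarith

theorem inv_pow_le_inv {k m : ℕ} (hk : 1 ≤ k) : ((m : ℝ) ^ k)⁻¹ ≤ (m : ℝ)⁻¹ := by
  rcases Nat.eq_zero_or_pos m with rfl | hm
  · simp [show k ≠ 0 by omega]
  · exact inv_anti₀ (by positivity) (le_self_pow₀ (by exact_mod_cast hm) (by omega))

theorem mhs_le_ell_pow {w : List ℕ} (hw : ∀ x ∈ w, 1 ≤ x) (N : ℕ) :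
    mhs w N ≤ ell N ^ w.length := by
  induction w generalizing N with
  | nil => simp [mhs_nil]
  | cons k w ih =>
    rw [List.forall_mem_cons] at hw
    rw [mhs_cons, List.length_cons, pow_succ']
    calc _ ≤ ∑ m ∈ Finset.Ico 1 N, (m : ℝ)⁻¹ * ell N ^ w.length := by
          refine Finset.sum_le_sum fun m hm => ?_
          refine mul_le_mul (inv_pow_le_inv hw.1) ((ih hw.2 m).trans ?_) (mhs_nonneg _ _)
            (by positivity)
          exact pow_le_pow_left₀ (by linarith [one_le_ell m])
            (ell_mono (Finset.mem_Ico.1 hm).2.le) _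
      _ = mhs [1] N * ell N ^ w.length := by rw [← Finset.sum_mul, mhs_one]
      _ ≤ _ := by
          refine mul_le_mul_of_nonneg_right ?_ (pow_nonneg (by linarith [one_le_ell N]) _)
          unfold ell; linarith

theorem mul_mhs_sub_le {w : List ℕ} (hw : ∀ x ∈ w, 1 ≤ x) {M N : ℕ} (hM : 1 ≤ M)
    (hMN : M ≤ N) : (N : ℝ) * (mhs w N - mhs w M) ≤ (N - M) * ell N ^ w.length := by
  have hMN' : (M : ℝ) ≤ N := by exact_mod_cast hMN
  cases w with
  | nil => simp [mhs_nil, hMN']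
  | cons k w =>
    rw [List.forall_mem_cons] at hw
    have hell : 0 ≤ ell N ^ w.length := pow_nonneg (by linarith [one_le_ell N]) _
    have h1 : mhs (k :: w) N - mhs (k :: w) M ≤
        (∑ m ∈ Finset.Ico M N, (m : ℝ)⁻¹) * ell N ^ w.length := by
      rw [mhs_cons, mhs_cons, ← Finset.sum_Ico_consecutive _ hM hMN, add_sub_cancel_left,
        Finset.sum_mul]
      refine Finset.sum_le_sum fun m hm => ?_
      refine mul_le_mul (inv_pow_le_inv hw.1) ((mhs_le_ell_pow hw.2 m).trans ?_)
        (mhs_nonneg _ _) (by positivity)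
      exact pow_le_pow_left₀ (by linarith [one_le_ell m])
        (ell_mono (Finset.mem_Ico.1 hm).2.le) _
    have h2 : (N : ℝ) * ∑ m ∈ Finset.Ico M N, (m : ℝ)⁻¹ ≤ (N - M) * ell N := by
      have h3 : ∑ m ∈ Finset.Ico M N, (m : ℝ)⁻¹ ≤ mhs [1] N := by
        rw [mhs_one]
        refine Finset.sum_le_sum_of_subset_of_nonneg (Finset.Ico_subset_Ico_left hM) ?_
        intros; positivity
      calc (N : ℝ) * ∑ m ∈ Finset.Ico M N, (m : ℝ)⁻¹
          ≤ ∑ m ∈ Finset.Ico M N, (1 + (N - M) * (m : ℝ)⁻¹) := by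
            rw [Finset.mul_sum]
            refine Finset.sum_le_sum fun m hm => ?_
            have hm' := (Finset.mem_Ico.1 hm).1
            have : (M : ℝ) ≤ m := by exact_mod_cast hm'
            have hm0 : (0 : ℝ) < m := by exact_mod_cast (show 0 < m by omega)
            rw [← sub_nonneg]
            have : 1 + ((N : ℝ) - M) * (m : ℝ)⁻¹ - N * (m : ℝ)⁻¹ = (m - M) * (m : ℝ)⁻¹ := by
              field_simp; ring
            rw [this]
            exact mul_nonneg (by linarith) (by positivity)
        _ = (N - M) * (1 + ∑ m ∈ Finset.Ico M N, (m : ℝ)⁻¹) := by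
            rw [Finset.sum_add_distrib, ← Finset.mul_sum, Finset.sum_const, Nat.card_Ico,
              nsmul_eq_mul, mul_one, Nat.cast_sub hMN]
            ring
        _ ≤ _ := by
            unfold ell
            exact mul_le_mul_of_nonneg_left (by linarith) (by linarith)
    rw [List.length_cons, pow_succ']
    calc (N : ℝ) * (mhs (k :: w) N - mhs (k :: w) M)
        ≤ (N : ℝ) * ((∑ m ∈ Finset.Ico M N, (m : ℝ)⁻¹) * ell N ^ w.length) := by gcongr
      _ = ((N : ℝ) * ∑ m ∈ Finset.Ico M N, (m : ℝ)⁻¹) * ell N ^ w.length := by ring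
      _ ≤ ((N - M) * ell N) * ell N ^ w.length := by gcongr
      _ = _ := by ring

theorem exists_ell_pow_le (p : ℕ) :
    ∃ C : ℝ, 0 ≤ C ∧ ∀ N : ℕ, 1 ≤ N → ell N ^ p ≤ C * (N : ℝ) ^ (1 / 4 : ℝ) := by
  set ε : ℝ := 1 / (4 * (p + 1)) with hε
  have hε0 : 0 < ε := by positivity
  refine ⟨(2 + 1 / ε) ^ (p + 1), by positivity, fun N hN => ?_⟩
  have hN' : (1 : ℝ) ≤ N := by exact_mod_cast hN
  have h1 : ell N ≤ 2 + Real.log N := by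
    have : mhs [1] N = (harmonic (N - 1) : ℝ) := by
      rw [mhs_one, Finset.sum_Ico_eq_sum_range, harmonic]
      push_cast
      exact Finset.sum_congr rfl fun _ _ => by rw [add_comm]
    have h2 := harmonic_le_one_add_log (N - 1)
    have h3 : Real.log ((N - 1 : ℕ) : ℝ) ≤ Real.log N := by
      rcases Nat.eq_zero_or_pos (N - 1) with h | h
      · rw [h]; simpa using Real.log_nonneg hN'
      · exact Real.log_le_log (by exact_mod_cast h) (by exact_mod_cast Nat.sub_le _ _)
    unfold ell
    linarith
  have h2 : ell N ≤ (2 + 1 / ε) * (N : ℝ) ^ ε := by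
    have h3 := Real.log_le_rpow_div (by positivity : (0 : ℝ) ≤ N) hε0
    have h4 : 1 ≤ (N : ℝ) ^ ε := Real.one_le_rpow hN' hε0.le
    have h5 : (N : ℝ) ^ ε / ε = 1 / ε * (N : ℝ) ^ ε := by ring
    rw [add_mul]
    linarith
  calc ell N ^ p ≤ ell N ^ (p + 1) := pow_le_pow_right₀ (one_le_ell N) (Nat.le_succ p)
    _ ≤ ((2 + 1 / ε) * (N : ℝ) ^ ε) ^ (p + 1) :=
        pow_le_pow_left₀ (by linarith [one_le_ell N]) h2 _
    _ = _ := by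
        rw [mul_pow, ← Real.rpow_natCast ((N : ℝ) ^ ε), ← Real.rpow_mul (by positivity), hε]
        congr 2
        push_cast
        field_simp

/-- Sequences that are bounded by a power of the harmonic numbers. -/
noncomputable def logBdd : Subalgebra ℝ (ℕ → ℝ) where
  carrier := {a | ∃ (C : ℝ) (p : ℕ), 0 ≤ C ∧ ∀ N, 1 ≤ N → |a N| ≤ C * ell N ^ p}
  mul_mem' := by
    rintro a b ⟨C, p, hC, ha⟩ ⟨D, q, hD, hb⟩
    refine ⟨C * D, p + q, by positivity, fun N hN => ?_⟩
    rw [Pi.mul_apply, abs_mul, pow_add]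
    calc _ ≤ (C * ell N ^ p) * (D * ell N ^ q) :=
          mul_le_mul (ha N hN) (hb N hN) (abs_nonneg _) ((abs_nonneg _).trans (ha N hN))
      _ = _ := by ring
  add_mem' := by
    rintro a b ⟨C, p, hC, ha⟩ ⟨D, q, hD, hb⟩
    refine ⟨C + D, p + q, by positivity, fun N hN => ?_⟩
    have h1 : ell N ^ p ≤ ell N ^ (p + q) := pow_le_pow_right₀ (one_le_ell N) (by omega)
    have h2 : ell N ^ q ≤ ell N ^ (p + q) := pow_le_pow_right₀ (one_le_ell N) (by omega)
    calc _ ≤ |a N| + |b N| := abs_add_le _ _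
      _ ≤ C * ell N ^ p + D * ell N ^ q := add_le_add (ha N hN) (hb N hN)
      _ ≤ C * ell N ^ (p + q) + D * ell N ^ (p + q) := by gcongr
      _ = _ := by ring
  algebraMap_mem' r := ⟨|r|, 0, abs_nonneg r, fun N _ => by simp⟩

theorem mem_logBdd {a : ℕ → ℝ} :
    a ∈ logBdd ↔ ∃ (C : ℝ) (p : ℕ), 0 ≤ C ∧ ∀ N, 1 ≤ N → |a N| ≤ C * ell N ^ p := Iff.rfl

theorem mhs_mem_logBdd {w : List ℕ} (hw : ∀ x ∈ w, 1 ≤ x) : mhs w ∈ logBdd :=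
  ⟨1, w.length, zero_le_one, fun N _ => by
    rw [abs_of_nonneg (mhs_nonneg _ _), one_mul]; exact mhs_le_ell_pow hw N⟩

/-- Sequences that are `O(N ^ (-1/2) (log N) ^ p)` for some `p`. -/
noncomputable def errors : Submodule ℝ (ℕ → ℝ) where
  carrier := {e | (fun N : ℕ => √(N : ℝ) * e N) ∈ logBdd}
  add_mem' := by
    intro a b ha hb
    change (fun N : ℕ => √(N : ℝ) * (a + b) N) ∈ logBdd
    convert logBdd.add_mem ha hb using 1
    ext N
    simp [mul_add]
  zero_mem' := by
    change (fun N : ℕ => √(N : ℝ) * (0 : ℕ → ℝ) N) ∈ logBdd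
    convert logBdd.zero_mem using 1
    ext N
    simp
  smul_mem' := by
    intro c a ha
    change (fun N : ℕ => √(N : ℝ) * (c • a) N) ∈ logBdd
    convert logBdd.smul_mem ha c using 1
    ext N
    simp only [Pi.smul_apply, smul_eq_mul]
    ring

theorem mem_errors {e : ℕ → ℝ} :
    e ∈ errors ↔ ∃ (C : ℝ) (p : ℕ), 0 ≤ C ∧ ∀ N : ℕ, 1 ≤ N → √(N : ℝ) * |e N| ≤ C * ell N ^ p := by
  have : ∀ N : ℕ, |√(N : ℝ) * e N| = √(N : ℝ) * |e N| := fun N => by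
    rw [abs_mul, abs_of_nonneg (Real.sqrt_nonneg _)]
  change (fun N : ℕ => √(N : ℝ) * e N) ∈ logBdd ↔ _
  simp only [mem_logBdd, this]

theorem errors_mul_mem {e a : ℕ → ℝ} (he : e ∈ errors) (ha : a ∈ logBdd) :
    e * a ∈ errors := by
  have := logBdd.mul_mem he ha
  change (fun N : ℕ => √(N : ℝ) * (e * a) N) ∈ logBdd
  convert this using 1
  ext N
  simp [mul_assoc]

theorem one_le_sqrt_natCast {N : ℕ} (hN : 1 ≤ N) : 1 ≤ √(N : ℝ) :=
  Real.one_le_sqrt.2 (by exact_mod_cast hN)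

theorem errors_le_logBdd {e : ℕ → ℝ} (he : e ∈ errors) : e ∈ logBdd := by
  obtain ⟨C, p, hC, h⟩ := mem_errors.1 he
  refine ⟨C, p, hC, fun N hN => le_trans ?_ (h N hN)⟩
  exact le_mul_of_one_le_left (abs_nonneg _) (one_le_sqrt_natCast hN)

theorem tendsto_ell_pow_div_sqrt (C : ℝ) (p : ℕ) :
    Tendsto (fun N : ℕ => C * ell N ^ p / √(N : ℝ)) atTop (𝓝 0) := by
  obtain ⟨D, hD, h⟩ := exists_ell_pow_le p
  have hlim : Tendsto (fun N : ℕ => D * (N : ℝ) ^ (-(1 / 4) : ℝ)) atTop (𝓝 0) := by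
    have := ((tendsto_rpow_neg_atTop (show (0 : ℝ) < 1 / 4 by norm_num)).comp
      tendsto_natCast_atTop_atTop).const_mul D
    simpa using this
  have h2 : Tendsto (fun N : ℕ => ell N ^ p / √(N : ℝ)) atTop (𝓝 0) := by
    refine squeeze_zero' (Eventually.of_forall fun N => ?_) ?_ hlim
    · have := one_le_ell N
      positivity
    · filter_upwards [eventually_ge_atTop 1] with N hN
      have hN' : (0 : ℝ) < N := by exact_mod_cast hN
      rw [div_le_iff₀ (Real.sqrt_pos.2 hN'), Real.sqrt_eq_rpow, mul_assoc, ← Real.rpow_add hN']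
      norm_num
      simpa using h N hN
  have := h2.const_mul C
  simpa [mul_div_assoc] using this

theorem errors_tendsto {e : ℕ → ℝ} (he : e ∈ errors) : Tendsto e atTop (𝓝 0) := by
  obtain ⟨C, p, hC, h⟩ := mem_errors.1 he
  refine squeeze_zero_norm' ?_ (tendsto_ell_pow_div_sqrt C p)
  filter_upwards [eventually_ge_atTop 1] with N hN
  have hN' : (0 : ℝ) < N := by exact_mod_cast hN
  rw [Real.norm_eq_abs, le_div_iff₀ (Real.sqrt_pos.2 hN'), mul_comm]
  exact h N hN

theorem tendsto_harmonic_atTop : Tendsto (mhs [1]) atTop atTop := by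
  rw [← tendsto_add_atTop_iff_nat 1]
  refine Real.tendsto_sum_range_one_div_nat_succ_atTop.congr fun n => ?_
  rw [mhs_one, Finset.sum_Ico_eq_sum_range]
  simp [add_comm]

/-- A convergent truncated multiple zeta value approaches its limit fast. -/
theorem mhs_sub_mem_errors {w : List ℕ} (hw : Adm w) {z : ℝ}
    (hz : Tendsto (mhs w) atTop (𝓝 z)) : (fun N => mhs w N - z) ∈ errors := by
  cases w with
  | nil =>
    have : z = 1 := tendsto_nhds_unique hz tendsto_const_nhds
    have h0 : (fun N => mhs [] N - z) = 0 := by ext N; simp [mhs_nil, this]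
    rw [h0]
    exact errors.zero_mem
  | cons k u =>
    obtain ⟨hk, hu⟩ := adm_cons.1 hw
    obtain ⟨D, hD, hell⟩ := exists_ell_pow_le u.length
    have step : ∀ N : ℕ, 1 ≤ N → mhs (k :: u) (N + 1) - mhs (k :: u) N ≤
        6 * D * ((√(N : ℝ))⁻¹ - (√((N + 1 : ℕ) : ℝ))⁻¹) := by
      intro N hN
      have hN' : (1 : ℝ) ≤ N := by exact_mod_cast hN
      rw [mhs_cons_succ _ _ hN, add_sub_cancel_left]
      set s := √(N : ℝ) with hs
      set t := √((N + 1 : ℕ) : ℝ) with ht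
      have hs2 : s ^ 2 = N := Real.sq_sqrt (by positivity)
      have ht2 : t ^ 2 = N + 1 := by rw [ht, Real.sq_sqrt (by positivity)]; push_cast; rfl
      have hs1 : 1 ≤ s := one_le_sqrt_natCast hN
      have ht1 : 1 ≤ t := one_le_sqrt_natCast (by omega)
      have hts : t ≤ 2 * s := by
        exact abs_le_of_sq_le_sq' (by nlinarith) (by positivity) |>.2
      have h1 : mhs u N ≤ D * s := by
        refine ((mhs_le_ell_pow hu N).trans (hell N hN)).trans ?_
        rw [hs, Real.sqrt_eq_rpow]
        exact mul_le_mul_of_nonneg_left (Real.rpow_le_rpow_of_exponent_le hN' (by norm_num)) hD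
      have h2 : ((N : ℝ) ^ k)⁻¹ ≤ (s ^ 4)⁻¹ := by
        rw [show s ^ 4 = (N : ℝ) ^ 2 by rw [← hs2]; ring]
        exact inv_anti₀ (by positivity) (pow_le_pow_right₀ hN' hk)
      have h3 : s⁻¹ - t⁻¹ = (s * t * (s + t))⁻¹ := by
        have : (t - s) * (s + t) = 1 := by nlinarith
        field_simp
        linarith
      calc ((N : ℝ) ^ k)⁻¹ * mhs u N ≤ (s ^ 4)⁻¹ * (D * s) :=
            mul_le_mul h2 h1 (mhs_nonneg _ _) (by positivity)
        _ = 6 * D * (s * (2 * s) * (s + 2 * s))⁻¹ := by field_simp; ring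
        _ ≤ 6 * D * (s * t * (s + t))⁻¹ := by gcongr
        _ = _ := by rw [h3]
    have tele : ∀ N : ℕ, 1 ≤ N → ∀ K, N ≤ K → mhs (k :: u) K - mhs (k :: u) N ≤
        6 * D * ((√(N : ℝ))⁻¹ - (√(K : ℝ))⁻¹) := by
      intro N hN K hK
      induction K, hK using Nat.le_induction with
      | base => simp
      | succ K hK ih => linarith [step K (hN.trans hK)]
    refine mem_errors.2 ⟨6 * D, 0, by positivity, fun N hN => ?_⟩
    have hpos : 0 < √(N : ℝ) := by linarith [one_le_sqrt_natCast hN]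
    have h1 : mhs (k :: u) N ≤ z :=
      ge_of_tendsto hz ((eventually_ge_atTop N).mono fun K hK => mhs_mono _ hK)
    have h2 : z ≤ mhs (k :: u) N + 6 * D * (√(N : ℝ))⁻¹ := by
      refine le_of_tendsto hz ((eventually_ge_atTop N).mono fun K hK => ?_)
      have h3 := tele N hN K hK
      have h4 : 0 ≤ 6 * D * (√(K : ℝ))⁻¹ := by positivity
      linarith
    rw [abs_of_nonpos (by linarith), pow_zero, mul_one]
    calc √(N : ℝ) * -(mhs (k :: u) N - z) ≤ √(N : ℝ) * (6 * D * (√(N : ℝ))⁻¹) := by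
          gcongr; linarith
      _ = 6 * D := by field_simp

end Growth

section Values

open Filter Topology

theorem strictMono_snoc_iff {d : ℕ} (m : Fin d → ℕ) (n : ℕ) :
    StrictMono (Fin.snoc m n : Fin (d + 1) → ℕ) ↔ StrictMono m ∧ ∀ i, m i < n := by
  constructor
  · intro h
    refine ⟨fun i j hij => ?_, fun i => ?_⟩
    · simpa using h (Fin.castSucc_lt_castSucc_iff.2 hij)
    · simpa using h (Fin.castSucc_lt_last i)
  · rintro ⟨h1, h2⟩ i j hij
    induction j using Fin.lastCases with
    | last =>
      induction i using Fin.lastCases with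
      | last => exact absurd hij (lt_irrefl _)
      | cast i => simpa using h2 i
    | cast j =>
      induction i using Fin.lastCases with
      | last => exact absurd hij (not_lt.2 (Fin.le_last _))
      | cast i => simpa using h1 (Fin.castSucc_lt_castSucc_iff.1 hij)

open Classical in
theorem mhs_reverse_ofFn {d : ℕ} (k : Fin d → ℕ) (N : ℕ) :
    mhs (List.ofFn k).reverse N =
      ∑ m ∈ (Fintype.piFinset fun _ : Fin d => Finset.Ico 1 N) with
        ((∀ i, 0 < m i) ∧ StrictMono m), ∏ i, ((m i : ℝ) ^ k i)⁻¹ := by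
  induction d generalizing N with
  | zero =>
    have : ∀ m : Fin 0 → ℕ, StrictMono m := fun m i => i.elim0
    simp [mhs_nil, this]
  | succ d ih =>
    rw [List.ofFn_succ', List.concat_eq_append, List.reverse_append, List.reverse_singleton,
      List.singleton_append, mhs_cons]
    simp only [ih, Finset.mul_sum]
    rw [Finset.sum_sigma']
    refine Finset.sum_bij' (fun x _ => (Fin.snoc x.2 x.1 : Fin (d + 1) → ℕ))
      (fun m _ => ⟨m (Fin.last d), fun i => m i.castSucc⟩) ?_ ?_ ?_ ?_ ?_
    · rintro ⟨n, m⟩ h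
      simp only [Finset.mem_sigma, Finset.mem_filter, Fintype.mem_piFinset, Finset.mem_Ico] at h ⊢
      obtain ⟨hn, hm, -, hmono⟩ := h
      refine ⟨fun i => ?_, fun i => ?_, (strictMono_snoc_iff m n).2 ⟨hmono, fun i => (hm i).2⟩⟩
      · induction i using Fin.lastCases with
        | last => simpa using hn
        | cast i => simpa using ⟨(hm i).1, (hm i).2.trans hn.2⟩
      · induction i using Fin.lastCases with
        | last => simpa using (show 0 < n by omega)
        | cast i => simpa using (show 0 < m i from (hm i).1)
    · intro m h
      simp only [Finset.mem_sigma, Finset.mem_filter, Fintype.mem_piFinset, Finset.mem_Ico] at h ⊢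
      obtain ⟨hm, h0, hmono⟩ := h
      refine ⟨hm _, fun i => ⟨h0 _, hmono (Fin.castSucc_lt_last i)⟩, fun i => h0 _, ?_⟩
      exact fun i j hij => hmono (Fin.castSucc_lt_castSucc_iff.2 hij)
    · rintro ⟨n, m⟩ _
      simp
    · intro m _
      ext i
      induction i using Fin.lastCases <;> simp
    · rintro ⟨n, m⟩ _
      rw [Fin.prod_univ_castSucc]
      simp only [Fin.snoc_castSucc, Fin.snoc_last]
      ring

theorem tendsto_mhs_zeta {d : ℕ} {k : Fin d → ℕ} (hk : MZV.Admissible k) :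
    Tendsto (mhs (List.ofFn k).reverse) atTop (𝓝 (MZV.zeta k)) := by
  classical
  have hsum : HasSum (MZV.term k) (MZV.zeta k) := (MZV.summable_term k hk).hasSum
  let S : ℕ → Finset (MZV.Tuples d) := fun N =>
    (Fintype.piFinset fun _ : Fin d => Finset.Ico 1 N).subtype _
  have hS : Tendsto S atTop atTop := by
    refine tendsto_atTop_finset_of_monotone (fun M N hMN m hm => ?_) (fun m => ?_)
    · simp only [S, Finset.mem_subtype, Fintype.mem_piFinset, Finset.mem_Ico] at hm ⊢
      exact fun i => ⟨(hm i).1, (hm i).2.trans_le hMN⟩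
    · refine ⟨∑ i, m.1 i + 1, ?_⟩
      simp only [S, Finset.mem_subtype, Fintype.mem_piFinset, Finset.mem_Ico]
      exact fun i => ⟨m.2.1 i, Nat.lt_succ_of_le
        (Finset.single_le_sum (fun j _ => Nat.zero_le (m.1 j)) (Finset.mem_univ i))⟩
  refine (hsum.comp hS).congr fun N => ?_
  rw [mhs_reverse_ofFn]
  have := Finset.sum_subtype_eq_sum_filter (s := Fintype.piFinset fun _ : Fin d => Finset.Ico 1 N)
    (p := fun m : Fin d → ℕ => (∀ i, 0 < m i) ∧ StrictMono m)
    (fun m : Fin d → ℕ => ∏ i, ((m i : ℝ) ^ k i)⁻¹)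
  rw [← this]
  simp only [Function.comp, S, MZV.term, one_div, Finset.prod_inv_distrib]

theorem adm_reverse_ofFn {d : ℕ} {k : Fin d → ℕ} (hk : MZV.Admissible k) :
    Adm (List.ofFn k).reverse := by
  refine ⟨fun x hx => ?_, ?_⟩
  · rw [List.mem_reverse, List.mem_ofFn] at hx
    obtain ⟨i, rfl⟩ := hx
    exact hk.1 i
  · cases d with
    | zero => simp
    | succ d =>
      rw [List.ofFn_succ', List.concat_eq_append, List.reverse_append, List.reverse_singleton,
        List.singleton_append]
      simpa using hk.2 (Fin.last d) (by simp)

/-- The multiple zeta value of a word. -/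
noncomputable def zetaWord (w : List ℕ) : ℝ :=
  MZV.zeta (fun i : Fin w.length => w.get i.rev)

theorem reverse_ofFn_get_rev (w : List ℕ) :
    (List.ofFn (fun i : Fin w.length => w.get i.rev)).reverse = w := by
  apply List.ext_getElem
  · simp
  · intro i h1 h2
    simp only [List.getElem_reverse, List.getElem_ofFn, List.get_eq_getElem, Fin.val_rev,
      List.length_ofFn]
    congr 1
    omega

theorem admissible_get_rev {w : List ℕ} (hw : Adm w) :
    MZV.Admissible (fun i : Fin w.length => w.get i.rev) := by
  refine ⟨fun i => hw.1 _ (List.get_mem _ _), fun i hi => ?_⟩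
  cases w with
  | nil => exact i.elim0
  | cons k w =>
    have h0 : i.rev = ⟨0, by simp⟩ := by
      apply Fin.ext
      rw [Fin.val_rev, hi, Nat.sub_self]
    simp only [h0]
    exact (adm_cons.1 hw).1

theorem tendsto_mhs_zetaWord {w : List ℕ} (hw : Adm w) :
    Tendsto (mhs w) atTop (𝓝 (zetaWord w)) := by
  have := tendsto_mhs_zeta (admissible_get_rev hw)
  rwa [reverse_ofFn_get_rev] at this

/-- The `ℚ[π²]`-module spanned by the multiple zeta values of depth at most `r`. -/
noncomputable abbrev depthSpan (r : ℕ) : Submodule MZV.ratPiSq ℝ :=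
  Submodule.span MZV.ratPiSq (MZV.valuesOfDepthLE r)

theorem zetaWord_mem {w : List ℕ} (hw : Adm w) {r : ℕ} (hr : w.length ≤ r) :
    zetaWord w ∈ depthSpan r :=
  Submodule.subset_span ⟨w.length, _, hr, admissible_get_rev hw, rfl⟩

theorem depthSpan_mono {r s : ℕ} (h : r ≤ s) : depthSpan r ≤ depthSpan s := by
  refine Submodule.span_mono ?_
  rintro x ⟨e, l, he, hl, rfl⟩
  exact ⟨e, l, he.trans h, hl, rfl⟩

theorem one_mem_depthSpan (r : ℕ) : (1 : ℝ) ∈ depthSpan r := by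
  refine Submodule.subset_span ⟨0, Fin.elim0, Nat.zero_le _,
    ⟨fun i => i.elim0, fun i => i.elim0⟩, ?_⟩
  rw [MZV.zeta_empty]

theorem mem_depthSpan_of_mem_ratPiSq {x : ℝ} (hx : x ∈ MZV.ratPiSq) (r : ℕ) :
    x ∈ depthSpan r := by
  have := (depthSpan r).smul_mem (⟨x, hx⟩ : MZV.ratPiSq) (one_mem_depthSpan r)
  rwa [Subalgebra.smul_def, smul_eq_mul, mul_one] at this

theorem zeta_mul_zeta_mem {d e : ℕ} {k : Fin d → ℕ} {l : Fin e → ℕ} (hk : MZV.Admissible k)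
    (hl : MZV.Admissible l) : MZV.zeta k * MZV.zeta l ∈ depthSpan (d + e) := by
  have hk' := adm_reverse_ofFn hk
  have hl' := adm_reverse_ofFn hl
  set u := (List.ofFn k).reverse with hu
  set v := (List.ofFn l).reverse with hv
  have h1 : Tendsto (fun N => mhs u N * mhs v N) atTop (𝓝 (MZV.zeta k * MZV.zeta l)) :=
    (tendsto_mhs_zeta hk).mul (tendsto_mhs_zeta hl)
  have h2 : Tendsto (fun N => mhs u N * mhs v N) atTop (𝓝 ((stuffle u v).map zetaWord).sum) := by
    simp only [mhs_mul]
    exact tendsto_list_sum _ fun c hc => tendsto_mhs_zetaWord (adm_of_mem_stuffle hk' hl' hc)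
  rw [tendsto_nhds_unique h1 h2]
  refine list_sum_mem fun x hx => ?_
  obtain ⟨c, hc, rfl⟩ := List.mem_map.1 hx
  refine zetaWord_mem (adm_of_mem_stuffle hk' hl' hc) ?_
  have := length_le_of_mem_stuffle hc
  simpa [hu, hv] using this

theorem mul_mem_depthSpan {r s : ℕ} {x y : ℝ} (hx : x ∈ depthSpan r) (hy : y ∈ depthSpan s) :
    x * y ∈ depthSpan (r + s) := by
  have h : depthSpan r * depthSpan s ≤ depthSpan (r + s) := by
    rw [Submodule.span_mul_span, Submodule.span_le]
    rintro _ ⟨_, ⟨d, k, hd, hk, rfl⟩, _, ⟨e, l, he, hl, rfl⟩, rfl⟩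
    exact depthSpan_mono (by omega) (zeta_mul_zeta_mem hk hl)
  exact h (Submodule.mul_mem_mul hx hy)

theorem rat_smul_mem_depthSpan {r : ℕ} (c : ℚ) {x : ℝ} (hx : x ∈ depthSpan r) :
    c • x ∈ depthSpan r :=
  Submodule.smul_of_tower_mem _ c hx

/-- Sequences that are, up to errors, polynomials in the harmonic numbers whose coefficients are
`ℚ[π²]`-linear combinations of multiple zeta values of depth at most `r`. -/
noncomputable def regular (r : ℕ) : Submodule ℚ (ℕ → ℝ) where
  carrier := {a | ∃ p : Polynomial ℝ, (∀ i, p.coeff i ∈ depthSpan r) ∧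
    (fun N => a N - p.eval (mhs [1] N)) ∈ errors}
  add_mem' := by
    rintro a b ⟨p, hp, ha⟩ ⟨q, hq, hb⟩
    refine ⟨p + q, fun i => ?_, ?_⟩
    · rw [Polynomial.coeff_add]; exact add_mem (hp i) (hq i)
    · convert errors.add_mem ha hb using 1
      ext N
      simp only [Pi.add_apply, Polynomial.eval_add]
      ring
  zero_mem' := ⟨0, by simp, by convert errors.zero_mem using 1; ext N; simp⟩
  smul_mem' := by
    rintro c a ⟨p, hp, ha⟩
    refine ⟨Polynomial.C (c : ℝ) * p, fun i => ?_, ?_⟩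
    · rw [Polynomial.coeff_C_mul, ← Rat.smul_def]
      exact rat_smul_mem_depthSpan c (hp i)
    · convert errors.smul_mem (c : ℝ) ha using 1
      ext N
      simp only [Pi.smul_apply, Polynomial.eval_mul, Polynomial.eval_C, smul_eq_mul, Rat.smul_def]
      ring

theorem mem_regular {r : ℕ} {a : ℕ → ℝ} : a ∈ regular r ↔ ∃ p : Polynomial ℝ,
    (∀ i, p.coeff i ∈ depthSpan r) ∧ (fun N => a N - p.eval (mhs [1] N)) ∈ errors := Iff.rfl

theorem regular_mono {r s : ℕ} (h : r ≤ s) {a : ℕ → ℝ} (ha : a ∈ regular r) : a ∈ regular s := by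
  obtain ⟨p, hp, he⟩ := ha
  exact ⟨p, fun i => depthSpan_mono h (hp i), he⟩

theorem errors_le_regular {e : ℕ → ℝ} (he : e ∈ errors) (r : ℕ) : e ∈ regular r :=
  ⟨0, by simp, by simpa using he⟩

theorem const_mem_regular {r : ℕ} {x : ℝ} (hx : x ∈ depthSpan r) : (fun _ => x) ∈ regular r := by
  refine ⟨Polynomial.C x, fun i => ?_, ?_⟩
  · rw [Polynomial.coeff_C]
    split_ifs
    · exact hx
    · exact zero_mem _
  · convert errors.zero_mem using 1
    ext N
    simp

theorem eval_harmonic_mem_logBdd (p : Polynomial ℝ) :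
    (fun N => p.eval (mhs [1] N)) ∈ logBdd := by
  have : (fun N => p.eval (mhs [1] N)) =
      ∑ i ∈ Finset.range (p.natDegree + 1), p.coeff i • (mhs [1]) ^ i := by
    ext N
    simp [Polynomial.eval_eq_sum_range]
  rw [this]
  exact sum_mem fun i _ => logBdd.smul_mem (pow_mem (mhs_mem_logBdd (by simp)) i) _

theorem regular_le_logBdd {r : ℕ} {a : ℕ → ℝ} (ha : a ∈ regular r) : a ∈ logBdd := by
  obtain ⟨p, -, he⟩ := ha
  convert logBdd.add_mem (errors_le_logBdd he) (eval_harmonic_mem_logBdd p) using 1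
  ext N
  simp

theorem mul_mem_regular {r s : ℕ} {a b : ℕ → ℝ} (ha : a ∈ regular r) (hb : b ∈ regular s) :
    a * b ∈ regular (r + s) := by
  have hb' := regular_le_logBdd hb
  obtain ⟨p, hp, he⟩ := ha
  obtain ⟨q, hq, hf⟩ := hb
  refine ⟨p * q, fun i => ?_, ?_⟩
  · rw [Polynomial.coeff_mul]
    exact sum_mem fun x _ => mul_mem_depthSpan (hp _) (hq _)
  · have h1 := errors_mul_mem he hb'
    have h2 := errors_mul_mem hf (eval_harmonic_mem_logBdd p)
    convert errors.add_mem h1 h2 using 1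
    ext N
    simp only [Pi.add_apply, Pi.mul_apply, Polynomial.eval_mul]
    ring

theorem harmonic_mem_regular : mhs [1] ∈ regular 0 := by
  refine ⟨Polynomial.X, fun i => ?_, ?_⟩
  · rw [Polynomial.coeff_X]
    split_ifs
    · exact one_mem_depthSpan 0
    · exact zero_mem _
  · convert errors.zero_mem using 1
    ext N
    simp

theorem list_sum_mem_regular {r : ℕ} (T : List (List ℕ)) (h : ∀ c ∈ T, mhs c ∈ regular r) :
    (fun N => (T.map (mhs · N)).sum) ∈ regular r := by
  induction T with
  | nil => exact (regular r).zero_mem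
  | cons c T ih =>
    rw [List.forall_mem_cons] at h
    exact (regular r).add_mem h.1 (ih h.2)

theorem mhs_mem_regular_of_adm {w : List ℕ} (hw : Adm w) : mhs w ∈ regular w.length := by
  have h1 := const_mem_regular (zetaWord_mem hw le_rfl)
  have h2 := errors_le_regular (mhs_sub_mem_errors hw (tendsto_mhs_zetaWord hw)) w.length
  convert (regular w.length).add_mem h1 h2 using 1
  ext N
  simp

theorem mhs_replicate_append_mem_regular (s : ℕ) {v : List ℕ} (hv : Adm v) :
    mhs (List.replicate s 1 ++ v) ∈ regular (s + v.length) := by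
  induction s using Nat.strong_induction_on generalizing v with
  | _ s ih =>
    cases s with
    | zero => simpa using mhs_mem_regular_of_adm hv
    | succ s =>
      obtain ⟨T, hT, h⟩ := exists_harmonic_mul_mhs s hv
      have h1 : mhs [1] * mhs (List.replicate s 1 ++ v) ∈ regular (s + 1 + v.length) :=
        regular_mono (by omega) (mul_mem_regular harmonic_mem_regular (ih s (by omega) hv))
      have h2 : (fun N => (T.map (mhs · N)).sum) ∈ regular (s + 1 + v.length) := by
        refine list_sum_mem_regular T fun c hc => ?_
        obtain ⟨i, x, rfl, hi, hx, hl⟩ := hT c hc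
        exact regular_mono hl (ih i (by omega) hx)
      convert (regular _).smul_mem ((s + 1 : ℚ)⁻¹) ((regular _).sub_mem h1 h2) using 1
      ext N
      simp only [Pi.smul_apply, Pi.sub_apply, Pi.mul_apply, h, add_sub_cancel_right, Rat.smul_def]
      push_cast
      field_simp

theorem exists_replicate_append {w : List ℕ} (hw : ∀ x ∈ w, 1 ≤ x) :
    ∃ s v, w = List.replicate s 1 ++ v ∧ Adm v := by
  induction w with
  | nil => exact ⟨0, [], rfl, adm_nil⟩
  | cons k w ih =>
    rw [List.forall_mem_cons] at hw
    rcases eq_or_ne k 1 with rfl | hk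
    · obtain ⟨s, v, rfl, hv⟩ := ih hw.2
      exact ⟨s + 1, v, rfl, hv⟩
    · exact ⟨0, k :: w, rfl, adm_cons.2 ⟨by omega, hw.2⟩⟩

theorem mhs_mem_regular {w : List ℕ} (hw : ∀ x ∈ w, 1 ≤ x) : mhs w ∈ regular w.length := by
  obtain ⟨s, v, rfl, hv⟩ := exists_replicate_append hw
  simpa using mhs_replicate_append_mem_regular s hv

/-- A constant sequence is regular only if its value is. -/
theorem mem_depthSpan_of_const_mem_regular {r : ℕ} {x : ℝ} (h : (fun _ => x) ∈ regular r) :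
    x ∈ depthSpan r := by
  obtain ⟨p, hp, he⟩ := h
  have hlim : Tendsto (fun N => p.eval (mhs [1] N)) atTop (𝓝 x) := by
    have := (errors_tendsto he).const_sub x
    simpa using this
  have hdeg : p.degree ≤ 0 := by
    by_contra hd
    have h1 := (p.abs_tendsto_atTop (not_le.1 hd)).comp tendsto_harmonic_atTop
    exact not_tendsto_nhds_of_tendsto_atTop h1 _ hlim.abs
  rw [Polynomial.eq_C_of_degree_le_zero hdeg] at hlim
  simp only [Polynomial.eval_C] at hlim
  rw [← tendsto_nhds_unique tendsto_const_nhds hlim]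
  exact hp 0

end Values

section TwoSided

open Filter Topology

theorem mul_abs_mhs_sub_le {w : List ℕ} (hw : ∀ x ∈ w, 1 ≤ x) {M N : ℕ} (hM : 1 ≤ M)
    (hN : 1 ≤ N) (hMN : M ≤ 2 * N) :
    (N : ℝ) * |mhs w M - mhs w N| ≤ |(M : ℝ) - N| * (2 * ell N) ^ w.length := by
  have hell := one_le_ell N
  rcases le_total M N with h | h
  · have h' : (M : ℝ) ≤ N := by exact_mod_cast h
    rw [abs_of_nonpos (by linarith [mhs_mono w h]), abs_of_nonpos (by linarith), neg_sub, neg_sub]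
    refine (mul_mhs_sub_le hw hM h).trans ?_
    refine mul_le_mul_of_nonneg_left (pow_le_pow_left₀ (by linarith) (by linarith) _) (by linarith)
  · have h' : (N : ℝ) ≤ M := by exact_mod_cast h
    rw [abs_of_nonneg (by linarith [mhs_mono w h]), abs_of_nonneg (by linarith)]
    calc (N : ℝ) * (mhs w M - mhs w N) ≤ M * (mhs w M - mhs w N) :=
          mul_le_mul_of_nonneg_right h' (by linarith [mhs_mono w h])
      _ ≤ (M - N) * ell M ^ w.length := mul_mhs_sub_le hw hN h
      _ ≤ _ := by
          refine mul_le_mul_of_nonneg_left ?_ (by linarith)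
          exact pow_le_pow_left₀ (by linarith [one_le_ell M])
            ((ell_mono hMN).trans (ell_two_mul_le N)) _

theorem twoSided_apply (v u : List ℕ) (A B : ℕ) :
    chain powInv v 0 (B : ℤ) * chain powInv u (-(A : ℤ)) 0 =
      (-1) ^ u.sum * (mhs v B * mhs u.reverse A) := by
  rw [chain_neg_zero, ← mhs]
  ring

theorem diagonal_mem_regular {d : ℕ} {E : ℤ → ℤ → ℝ} (hE : E ∈ Submodule.span ℚ (twoSided d)) :
    (fun N : ℕ => E N N) ∈ regular d := by
  induction hE using Submodule.span_induction with
  | mem E h =>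
    obtain ⟨v, u, hd, hv, hu, rfl⟩ := h
    simp only [twoSided_apply]
    have h1 : mhs v * mhs u.reverse ∈ regular d := by
      rw [← hd]
      have := mhs_mem_regular (w := u.reverse) (by simpa using hu)
      rw [List.length_reverse] at this
      exact mul_mem_regular (mhs_mem_regular hv.1) this
    convert (regular d).smul_mem ((-1 : ℚ) ^ u.sum) h1 using 1
    ext N
    simp only [Pi.smul_apply, Pi.mul_apply, Rat.smul_def]
    push_cast
    rfl
  | zero => exact (regular d).zero_mem
  | add E F _ _ h1 h2 => exact (regular d).add_mem h1 h2
  | smul c E _ h => exact (regular d).smul_mem c h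

theorem exists_lipschitz {d : ℕ} {E : ℤ → ℤ → ℝ} (hE : E ∈ Submodule.span ℚ (twoSided d)) :
    ∃ (C : ℝ) (p : ℕ), 0 ≤ C ∧ ∀ A B N : ℕ, 1 ≤ A → 1 ≤ B → A + B = 2 * N →
      (N : ℝ) * |E A B - E N N| ≤ C * |(A : ℝ) - N| * ell N ^ p := by
  induction hE using Submodule.span_induction with
  | mem E h =>
    obtain ⟨v, u, hd, hv, hu, rfl⟩ := h
    have hu' : ∀ x ∈ u.reverse, 1 ≤ x := by simpa using hu
    refine ⟨2 * 2 ^ (v.length + u.length), v.length + u.length, by positivity, ?_⟩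
    intro A B N hA hB hAB
    simp only [twoSided_apply]
    have hell := one_le_ell N
    have hBN : |(B : ℝ) - N| = |(A : ℝ) - N| := by
      have : (A : ℝ) + B = 2 * N := by exact_mod_cast hAB
      rw [show (B : ℝ) - N = -(A - N) by linarith, abs_neg]
    have h1 := mul_abs_mhs_sub_le hu' hA (show 1 ≤ N by omega) (by omega)
    have h2 := mul_abs_mhs_sub_le hv.1 hB (show 1 ≤ N by omega) (by omega)
    rw [hBN] at h2
    rw [List.length_reverse] at h1
    have h3 : |mhs v B| ≤ (2 * ell N) ^ v.length := by
      rw [abs_of_nonneg (mhs_nonneg _ _)]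
      refine (mhs_le_ell_pow hv.1 B).trans (pow_le_pow_left₀ (by linarith [one_le_ell B]) ?_ _)
      exact (ell_mono (by omega)).trans (ell_two_mul_le N)
    have h4 : |mhs u.reverse N| ≤ (2 * ell N) ^ u.length := by
      rw [abs_of_nonneg (mhs_nonneg _ _)]
      refine (mhs_le_ell_pow hu' N).trans ?_
      rw [List.length_reverse]
      exact pow_le_pow_left₀ (by linarith) (by linarith) _
    have habs : |(-1 : ℝ) ^ u.sum| = 1 := by simp
    rw [← mul_sub, abs_mul, habs, one_mul]
    have hsplit : mhs v B * mhs u.reverse A - mhs v N * mhs u.reverse N =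
        mhs v B * (mhs u.reverse A - mhs u.reverse N) +
        (mhs v B - mhs v N) * mhs u.reverse N := by ring
    rw [hsplit]
    calc (N : ℝ) * |mhs v B * (mhs u.reverse A - mhs u.reverse N) +
          (mhs v B - mhs v N) * mhs u.reverse N|
        ≤ N * (|mhs v B| * |mhs u.reverse A - mhs u.reverse N| +
          |mhs v B - mhs v N| * |mhs u.reverse N|) := by
          gcongr
          refine (abs_add_le _ _).trans ?_
          rw [abs_mul, abs_mul]
      _ = |mhs v B| * (N * |mhs u.reverse A - mhs u.reverse N|) +
          (N * |mhs v B - mhs v N|) * |mhs u.reverse N| := by ring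
      _ ≤ (2 * ell N) ^ v.length * (|(A : ℝ) - N| * (2 * ell N) ^ u.length) +
          (|(A : ℝ) - N| * (2 * ell N) ^ v.length) * (2 * ell N) ^ u.length := by gcongr
      _ = _ := by rw [pow_add, pow_add, mul_pow, mul_pow]; ring
  | zero => exact ⟨0, 0, le_rfl, fun A B N _ _ _ => by simp⟩
  | add E F _ _ h1 h2 =>
    obtain ⟨C, p, hC, h1⟩ := h1
    obtain ⟨D, q, hD, h2⟩ := h2
    refine ⟨C + D, p + q, by positivity, fun A B N hA hB hAB => ?_⟩
    have hp : ell N ^ p ≤ ell N ^ (p + q) := pow_le_pow_right₀ (one_le_ell N) (by omega)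
    have hq : ell N ^ q ≤ ell N ^ (p + q) := pow_le_pow_right₀ (one_le_ell N) (by omega)
    calc (N : ℝ) * |(E + F) A B - (E + F) N N|
        ≤ N * (|E A B - E N N| + |F A B - F N N|) := by
          gcongr
          rw [show (E + F) (A : ℤ) B - (E + F) N N = (E A B - E N N) + (F A B - F N N) by
            simp only [Pi.add_apply]; ring]
          exact abs_add_le _ _
      _ = N * |E A B - E N N| + N * |F A B - F N N| := by ring
      _ ≤ C * |(A : ℝ) - N| * ell N ^ p + D * |(A : ℝ) - N| * ell N ^ q :=
          add_le_add (h1 A B N hA hB hAB) (h2 A B N hA hB hAB)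
      _ ≤ C * |(A : ℝ) - N| * ell N ^ (p + q) + D * |(A : ℝ) - N| * ell N ^ (p + q) := by gcongr
      _ = _ := by ring
  | smul c E _ h =>
    obtain ⟨C, p, hC, h⟩ := h
    refine ⟨|(c : ℝ)| * C, p, by positivity, fun A B N hA hB hAB => ?_⟩
    simp only [Pi.smul_apply, Rat.smul_def]
    rw [← mul_sub, abs_mul]
    calc _ = |(c : ℝ)| * (N * |E A B - E N N|) := by ring
      _ ≤ |(c : ℝ)| * (C * |(A : ℝ) - N| * ell N ^ p) :=
          mul_le_mul_of_nonneg_left (h A B N hA hB hAB) (abs_nonneg _)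
      _ = _ := by ring

theorem exists_approx {d : ℕ} {E : ℤ → ℤ → ℝ} (hE : E ∈ Submodule.span ℚ (twoSided d)) :
    ∃ (q : Polynomial ℝ) (C : ℝ) (p : ℕ), 0 ≤ C ∧ ∀ A B : ℕ, 1 ≤ A → 1 ≤ B →
      |E A B - q.eval (mhs [1] A)| ≤
        C * (ell A * ell B) ^ p * ((√(A : ℝ))⁻¹ + (√(B : ℝ))⁻¹) := by
  induction hE using Submodule.span_induction with
  | mem E h =>
    obtain ⟨v, u, hd, hv, hu, rfl⟩ := h
    obtain ⟨q, -, he⟩ := mem_regular.1 (mhs_mem_regular (w := u.reverse) (by simpa using hu))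
    obtain ⟨C, p, hC, h1⟩ := mem_errors.1 he
    obtain ⟨D, r, hD, h2⟩ := mem_errors.1 (mhs_sub_mem_errors hv (tendsto_mhs_zetaWord hv))
    obtain ⟨K, s, hK, h3⟩ := mem_logBdd.1 (mhs_mem_logBdd (w := u.reverse) (by simpa using hu))
    set z := zetaWord v
    refine ⟨Polynomial.C ((-1) ^ u.sum * z) * q, D * K + |z| * C, r + s + p, by positivity, ?_⟩
    intro A B hA hB
    have hA' : 0 < √(A : ℝ) := by linarith [one_le_sqrt_natCast hA]
    have hB' : 0 < √(B : ℝ) := by linarith [one_le_sqrt_natCast hB]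
    have habs : |(-1 : ℝ) ^ u.sum| = 1 := by simp
    simp only [twoSided_apply, Polynomial.eval_mul, Polynomial.eval_C]
    rw [show (-1) ^ u.sum * (mhs v B * mhs u.reverse A) -
      (-1) ^ u.sum * z * q.eval (mhs [1] A) = (-1) ^ u.sum * ((mhs v B - z) * mhs u.reverse A +
        z * (mhs u.reverse A - q.eval (mhs [1] A))) by ring, abs_mul, habs, one_mul]
    have hlA := one_le_ell A
    have hlB := one_le_ell B
    have h1' : |mhs u.reverse A - q.eval (mhs [1] A)| ≤ C * ell A ^ p * (√(A : ℝ))⁻¹ := by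
      rw [← div_eq_mul_inv, le_div_iff₀ hA', mul_comm]
      exact h1 A hA
    have h2' : |mhs v B - z| ≤ D * ell B ^ r * (√(B : ℝ))⁻¹ := by
      rw [← div_eq_mul_inv, le_div_iff₀ hB', mul_comm]
      exact h2 B hB
    have h4 : ell B ^ r * ell A ^ s ≤ (ell A * ell B) ^ (r + s + p) := by
      rw [mul_pow, mul_comm]
      gcongr <;> first | assumption | omega
    have h5 : ell A ^ p ≤ (ell A * ell B) ^ (r + s + p) := by
      rw [mul_pow, ← mul_one (ell A ^ p)]
      gcongr
      · omega
      · exact one_le_pow₀ hlB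
    calc |(mhs v B - z) * mhs u.reverse A + z * (mhs u.reverse A - q.eval (mhs [1] A))|
        ≤ |mhs v B - z| * |mhs u.reverse A| +
          |z| * |mhs u.reverse A - q.eval (mhs [1] A)| := by
          refine (abs_add_le _ _).trans ?_
          rw [abs_mul, abs_mul]
      _ ≤ (D * ell B ^ r * (√(B : ℝ))⁻¹) * (K * ell A ^ s) +
          |z| * (C * ell A ^ p * (√(A : ℝ))⁻¹) := by
          gcongr
          exact h3 A hA
      _ = D * K * (ell B ^ r * ell A ^ s) * (√(B : ℝ))⁻¹ +
          |z| * C * ell A ^ p * (√(A : ℝ))⁻¹ := by ring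
      _ ≤ D * K * (ell A * ell B) ^ (r + s + p) * ((√(A : ℝ))⁻¹ + (√(B : ℝ))⁻¹) +
          |z| * C * (ell A * ell B) ^ (r + s + p) * ((√(A : ℝ))⁻¹ + (√(B : ℝ))⁻¹) := by
          gcongr
          · exact le_add_of_nonneg_left (by positivity)
          · exact le_add_of_nonneg_right (by positivity)
      _ = _ := by ring
  | zero => exact ⟨0, 0, 0, le_rfl, fun A B _ _ => by simp⟩
  | add E F _ _ h1 h2 =>
    obtain ⟨q1, C, p, hC, h1⟩ := h1
    obtain ⟨q2, D, q, hD, h2⟩ := h2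
    refine ⟨q1 + q2, C + D, p + q, by positivity, fun A B hA hB => ?_⟩
    have hl : 1 ≤ ell A * ell B := one_le_mul_of_one_le_of_one_le (one_le_ell A) (one_le_ell B)
    have hp : (ell A * ell B) ^ p ≤ (ell A * ell B) ^ (p + q) := pow_le_pow_right₀ hl (by omega)
    have hq : (ell A * ell B) ^ q ≤ (ell A * ell B) ^ (p + q) := pow_le_pow_right₀ hl (by omega)
    rw [Polynomial.eval_add, show (E + F) (A : ℤ) B - (q1.eval (mhs [1] A) + q2.eval (mhs [1] A)) =
      (E A B - q1.eval (mhs [1] A)) + (F A B - q2.eval (mhs [1] A)) by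
        simp only [Pi.add_apply]; ring]
    refine (abs_add_le _ _).trans ((add_le_add (h1 A B hA hB) (h2 A B hA hB)).trans ?_)
    rw [add_mul, add_mul]
    gcongr
  | smul c E _ h =>
    obtain ⟨q, C, p, hC, h⟩ := h
    refine ⟨Polynomial.C (c : ℝ) * q, |(c : ℝ)| * C, p, by positivity, fun A B hA hB => ?_⟩
    simp only [Pi.smul_apply, Rat.smul_def, Polynomial.eval_mul, Polynomial.eval_C]
    rw [← mul_sub, abs_mul, mul_assoc, mul_assoc]
    gcongr
    rw [← mul_assoc]
    exact h A B hA hB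

end TwoSided

section Sums

open Filter Topology

theorem sum_inv_sqrt_le (N : ℕ) : ∑ m ∈ Finset.Ico 1 N, (√(m : ℝ))⁻¹ ≤ 3 * √(N : ℝ) := by
  induction N with
  | zero => simp
  | succ N ih =>
    rcases Nat.eq_zero_or_pos N with rfl | hN
    · simp
    rw [Finset.sum_Ico_succ_top (show 1 ≤ N from hN)]
    set s := √(N : ℝ) with hs
    set t := √((N + 1 : ℕ) : ℝ) with ht
    have hs2 : s ^ 2 = N := Real.sq_sqrt (by positivity)
    have ht2 : t ^ 2 = N + 1 := by rw [ht, Real.sq_sqrt (by positivity)]; push_cast; rfl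
    have hs1 : 1 ≤ s := one_le_sqrt_natCast hN
    have ht1 : 1 ≤ t := one_le_sqrt_natCast (by omega)
    have hts : t ≤ 2 * s := (abs_le_of_sq_le_sq' (by nlinarith) (by positivity)).2
    have hst : 0 < t - s := by nlinarith
    have h1 : s⁻¹ ≤ 3 * (t - s) := by
      rw [inv_le_iff_one_le_mul₀ (by positivity)]
      nlinarith
    linarith

/-- The sum of `n ^ (-s) * E (N + n) (N - n)` over `0 < |n| < N`. -/
noncomputable def symSum (s : ℕ) (E : ℤ → ℤ → ℝ) (N : ℕ) : ℝ :=
  ∑ n ∈ Finset.Ico 1 N, ((n : ℝ) ^ s)⁻¹ *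
    (E (N + n : ℕ) (N - n : ℕ) + (-1) ^ s * E (N - n : ℕ) (N + n : ℕ))

theorem sum_Ioo_symm {M : Type*} [AddCommMonoid M] (g : ℤ → M) (N : ℕ) :
    ∑ m ∈ (Finset.Ioo (-(N : ℤ)) N).erase 0, g m =
      ∑ n ∈ Finset.Ico 1 N, (g n + g (-n)) := by
  have h1 : (Finset.Ioo (-(N : ℤ)) N).erase 0 = Finset.Ioo 0 (N : ℤ) ∪ Finset.Ioo (-(N : ℤ)) 0 := by
    ext x; simp only [Finset.mem_erase, Finset.mem_Ioo, Finset.mem_union]; omega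
  rw [h1, Finset.sum_union, Finset.sum_add_distrib, sum_Ioo_zero_natCast,
    ← sum_Ioo_zero_natCast (fun m => g (-m))]
  · congr 1
    refine Finset.sum_nbij' (fun m => -m) (fun m => -m) ?_ ?_ ?_ ?_ ?_
    · intro m; simp only [Finset.mem_Ioo]; omega
    · intro m; simp only [Finset.mem_Ioo]; omega
    · simp
    · simp
    · simp
  · rw [Finset.disjoint_left]; intro x; simp only [Finset.mem_Ioo]; omega

theorem sum_powInv_eq_symSum (s : ℕ) (E : ℤ → ℤ → ℝ) (N : ℕ) :
    ∑ n ∈ (Finset.Ioo (-(N : ℤ)) N).erase 0, powInv n s * E (N + n) (N - n) = symSum s E N := by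
  rw [sum_Ioo_symm, symSum]
  refine Finset.sum_congr rfl fun n hn => ?_
  have hn := (Finset.mem_Ico.1 hn).2
  have h1 : powInv (-n) s = (-1) ^ s * ((n : ℝ) ^ s)⁻¹ := by
    simp only [powInv]
    push_cast
    rw [neg_pow, mul_inv]
    rcases neg_one_pow_eq_or ℝ s with h | h <;> rw [h] <;> norm_num
  rw [h1, powInv]
  push_cast [hn.le]
  rw [sub_neg_eq_add, ← sub_eq_add_neg]
  ring

theorem tendsto_mhs_even {j : ℕ} (hj : j ≠ 0) :
    ∃ z ∈ MZV.ratPiSq, Tendsto (mhs [2 * j]) atTop (𝓝 z) := by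
  refine ⟨_, ?_, (hasSum_zeta_nat hj).tendsto_sum_nat.congr fun N => ?_⟩
  rotate_left
  · rw [mhs_cons, Finset.range_eq_Ico]
    rcases Nat.eq_zero_or_pos N with rfl | hN
    · simp
    rw [Finset.sum_eq_sum_Ico_succ_bot hN]
    simp [mhs_nil, hj]
  · have hpi : Real.pi ^ 2 ∈ MZV.ratPiSq := Algebra.subset_adjoin rfl
    have h1 := MZV.ratPiSq.smul_mem (pow_mem hpi j)
      ((-1 : ℚ) ^ (j + 1) * 2 ^ (2 * j - 1) * bernoulli (2 * j) / (2 * j).factorial)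
    convert h1 using 1
    rw [Rat.smul_def]
    push_cast
    ring

theorem sign_mul_mhs_mem_regular {s : ℕ} (hs : 2 ≤ s) :
    (fun N => (1 + (-1) ^ s) * mhs [s] N) ∈ regular 0 := by
  rcases Nat.even_or_odd s with h | h
  · obtain ⟨j, hj⟩ := h
    obtain rfl : s = 2 * j := by omega
    obtain ⟨z, hz, hlim⟩ := tendsto_mhs_even (j := j) (by omega)
    have h1 := errors_le_regular
      (mhs_sub_mem_errors (adm_cons.2 ⟨hs, by simp⟩) hlim) 0
    have h2 := const_mem_regular (mem_depthSpan_of_mem_ratPiSq hz 0)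
    convert (regular 0).smul_mem 2 ((regular 0).add_mem h1 h2) using 1
    ext N
    simp only [Pi.smul_apply, Pi.add_apply, Rat.smul_def]
    rw [(even_two_mul j).neg_one_pow]
    push_cast
    ring
  · convert (regular 0).zero_mem using 1
    ext N
    simp [h.neg_one_pow]

theorem abs_natCast_add_sub (N n : ℕ) : |((N + n : ℕ) : ℝ) - N| = n := by
  push_cast
  rw [add_sub_cancel_left, abs_of_nonneg (by positivity)]

theorem abs_natCast_sub_sub {N n : ℕ} (h : n ≤ N) : |((N - n : ℕ) : ℝ) - N| = n := by
  push_cast [h]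
  rw [show (N : ℝ) - n - N = -n by ring, abs_neg, abs_of_nonneg (by positivity)]

theorem symSum_mem_regular {d s : ℕ} (hs : 2 ≤ s) {E : ℤ → ℤ → ℝ}
    (hE : E ∈ Submodule.span ℚ (twoSided d)) : symSum s E ∈ regular d := by
  obtain ⟨C, p, hC, hlip⟩ := exists_lipschitz hE
  have h1 : (fun N : ℕ => ∑ n ∈ Finset.Ico 1 N, ((n : ℝ) ^ s)⁻¹ *
      ((E (N + n : ℕ) (N - n : ℕ) - E N N) + (-1) ^ s * (E (N - n : ℕ) (N + n : ℕ) - E N N)))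
      ∈ errors := by
    refine mem_errors.2 ⟨2 * C, p + 1, by positivity, fun N hN => ?_⟩
    have hN' : (0 : ℝ) < N := by exact_mod_cast hN
    have hell := one_le_ell N
    have habs : |(-1 : ℝ) ^ s| = 1 := by simp
    have hb : ∀ n ∈ Finset.Ico 1 N, |((n : ℝ) ^ s)⁻¹ * ((E (N + n : ℕ) (N - n : ℕ) - E N N) +
        (-1) ^ s * (E (N - n : ℕ) (N + n : ℕ) - E N N))| ≤
        (2 * C * ell N ^ p / N) * (n : ℝ)⁻¹ := by
      intro n hn
      have hn := Finset.mem_Ico.1 hn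
      have hn' : (0 : ℝ) < n := by exact_mod_cast hn.1
      have l1 := hlip (N + n) (N - n) N (by omega) (by omega) (by omega)
      have l2 := hlip (N - n) (N + n) N (by omega) (by omega) (by omega)
      rw [abs_natCast_add_sub] at l1
      rw [abs_natCast_sub_sub hn.2.le] at l2
      rw [← le_div_iff₀' hN'] at l1 l2
      have h2 : ((n : ℝ) ^ s)⁻¹ ≤ ((n : ℝ) ^ 2)⁻¹ :=
        inv_anti₀ (by positivity) (pow_le_pow_right₀ (by exact_mod_cast hn.1) hs)
      rw [abs_mul, abs_of_nonneg (by positivity : 0 ≤ ((n : ℝ) ^ s)⁻¹)]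
      calc _ ≤ ((n : ℝ) ^ 2)⁻¹ * (C * n * ell N ^ p / N + C * n * ell N ^ p / N) := by
            refine mul_le_mul h2 ((abs_add_le _ _).trans ?_) (abs_nonneg _) (by positivity)
            rw [abs_mul, habs, one_mul]
            exact add_le_add l1 l2
        _ = _ := by field_simp; ring
    have hsum : |∑ n ∈ Finset.Ico 1 N, ((n : ℝ) ^ s)⁻¹ * ((E (N + n : ℕ) (N - n : ℕ) - E N N) +
        (-1) ^ s * (E (N - n : ℕ) (N + n : ℕ) - E N N))| ≤ 2 * C * ell N ^ p / N * ell N := by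
      refine (Finset.abs_sum_le_sum_abs _ _).trans ((Finset.sum_le_sum hb).trans ?_)
      rw [← Finset.mul_sum, ← mhs_one]
      gcongr
      unfold ell
      linarith
    have hsq : √(N : ℝ) ≤ N := by
      have : (1 : ℝ) ≤ N := by exact_mod_cast hN
      exact Real.sqrt_le_iff.2 ⟨by positivity, by nlinarith⟩
    calc _ ≤ (N : ℝ) * (2 * C * ell N ^ p / N * ell N) := by gcongr
      _ = _ := by field_simp; ring
  have h2 := mul_mem_regular (sign_mul_mhs_mem_regular hs) (diagonal_mem_regular hE)
  rw [zero_add] at h2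
  convert (regular d).add_mem (errors_le_regular h1 d) h2 using 1
  ext N
  simp only [Pi.add_apply, Pi.mul_apply]
  rw [mhs_cons, Finset.mul_sum, Finset.sum_mul, ← Finset.sum_add_distrib, symSum]
  refine Finset.sum_congr rfl fun n _ => ?_
  rw [mhs_nil]
  ring

theorem not_pos_leadingCoeff {q : Polynomial ℝ} {C : ℝ} {p : ℕ} (hC : 0 ≤ C)
    (h : ∀ N : ℕ, 1 ≤ N → |∑ A ∈ Finset.Ico 1 (2 * N), q.eval (mhs [1] A)| ≤
      C * ell N ^ p * √(N : ℝ)) : ¬ 0 < q.leadingCoeff := by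
  intro hq
  obtain ⟨c, hc, hev⟩ : ∃ c : ℝ, 0 < c ∧ ∀ᶠ A in atTop, c ≤ q.eval (mhs [1] A) := by
    rcases le_or_gt q.degree 0 with hd | hd
    · refine ⟨q.leadingCoeff, hq, Eventually.of_forall fun A => ?_⟩
      rw [Polynomial.eq_C_of_degree_le_zero hd]
      simp
    · refine ⟨1, one_pos, ?_⟩
      exact ((q.tendsto_atTop_of_leadingCoeff_nonneg hd hq.le).comp
        tendsto_harmonic_atTop).eventually_ge_atTop 1
  obtain ⟨M, hM⟩ := eventually_atTop.1 hev
  set D : ℝ := C * 2 ^ p * 2 + C with hD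
  have key : ∀ᶠ N : ℕ in atTop, c ≤ D * ell N ^ p / √(N : ℝ) := by
    filter_upwards [eventually_ge_atTop (max M 1)] with N hN
    have hN1 : 1 ≤ N := (le_max_right _ _).trans hN
    have hNM : M ≤ N := (le_max_left _ _).trans hN
    have hN' : (0 : ℝ) < N := by exact_mod_cast hN1
    have hell := one_le_ell N
    have h1 := h N hN1
    have h2 := h (2 * N) (by omega)
    rw [← Finset.sum_Ico_consecutive _ (show 1 ≤ 2 * N by omega)
      (show 2 * N ≤ 2 * (2 * N) by omega)] at h2
    have h3 : c * N ≤ ∑ A ∈ Finset.Ico (2 * N) (2 * (2 * N)), q.eval (mhs [1] A) := by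
      calc c * N ≤ ∑ A ∈ Finset.Ico (2 * N) (2 * (2 * N)), c := by
            rw [Finset.sum_const, Nat.card_Ico, show 2 * (2 * N) - 2 * N = 2 * N by omega,
              nsmul_eq_mul]
            push_cast
            nlinarith
        _ ≤ _ := Finset.sum_le_sum fun A hA => hM A (by have := (Finset.mem_Ico.1 hA).1; omega)
    have h4 : √((2 * N : ℕ) : ℝ) ≤ 2 * √(N : ℝ) := by
      rw [Real.sqrt_le_left (by positivity), mul_pow, Real.sq_sqrt hN'.le]
      push_cast
      linarith
    have h5 : C * ell (2 * N) ^ p * √((2 * N : ℕ) : ℝ) ≤ C * (2 * ell N) ^ p * (2 * √(N : ℝ)) := by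
      have := one_le_ell (2 * N)
      gcongr
      exact ell_two_mul_le N
    have h6 : c * N ≤ D * ell N ^ p * √(N : ℝ) := by
      have e1 := (abs_le.1 h1).1
      have e2 := (abs_le.1 h2).2
      rw [mul_pow] at h5
      rw [hD]
      linarith
    have hsq : √(N : ℝ) * √(N : ℝ) = N := Real.mul_self_sqrt hN'.le
    have hs0 : 0 < √(N : ℝ) := Real.sqrt_pos.2 hN'
    rw [le_div_iff₀ hs0]
    refine le_of_mul_le_mul_right ?_ hs0
    rw [mul_assoc, hsq]
    exact h6
  exact absurd (ge_of_tendsto (tendsto_ell_pow_div_sqrt D p) key) (not_le.2 hc)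

theorem eq_zero_of_sum_eval_le {q : Polynomial ℝ} {C : ℝ} {p : ℕ} (hC : 0 ≤ C)
    (h : ∀ N : ℕ, 1 ≤ N → |∑ A ∈ Finset.Ico 1 (2 * N), q.eval (mhs [1] A)| ≤
      C * ell N ^ p * √(N : ℝ)) : q = 0 := by
  have h1 := not_pos_leadingCoeff hC h
  have h2 : ¬ 0 < (-q).leadingCoeff := by
    refine not_pos_leadingCoeff (p := p) hC fun N hN => ?_
    simp only [Polynomial.eval_neg, Finset.sum_neg_distrib, abs_neg]
    exact h N hN
  rw [Polynomial.leadingCoeff_neg] at h2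
  exact Polynomial.leadingCoeff_eq_zero.1 (by linarith)

theorem sum_Ico_symm (g : ℕ → ℝ) {N : ℕ} (hN : 1 ≤ N) :
    ∑ A ∈ Finset.Ico 1 (2 * N), g A =
      g N + ∑ n ∈ Finset.Ico 1 N, (g (N + n) + g (N - n)) := by
  rw [← Finset.sum_Ico_consecutive _ hN (show N ≤ 2 * N by omega),
    Finset.sum_eq_sum_Ico_succ_bot (show N < 2 * N by omega), Finset.sum_add_distrib]
  have h1 : ∑ A ∈ Finset.Ico (N + 1) (2 * N), g A = ∑ n ∈ Finset.Ico 1 N, g (N + n) := by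
    refine Finset.sum_nbij' (fun A => A - N) (fun n => N + n) ?_ ?_ ?_ ?_ ?_ <;>
      intro m hm <;> simp only [Finset.mem_Ico] at * <;> first | omega | (congr 1; omega)
  have h2 : ∑ A ∈ Finset.Ico 1 N, g A = ∑ n ∈ Finset.Ico 1 N, g (N - n) := by
    refine Finset.sum_nbij' (fun A => N - A) (fun n => N - n) ?_ ?_ ?_ ?_ ?_ <;>
      intro m hm <;> simp only [Finset.mem_Ico] at * <;> first | omega | (congr 1; omega)
  rw [h1, h2]
  ring

/-- Residues that add up to zero contribute only an error. -/
theorem symSum_one_mem_errors {d : ℕ} {E : ℤ → ℤ → ℝ} (hE : E ∈ Submodule.span ℚ (twoSided d))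
    (h0 : ∀ N : ℕ, 1 ≤ N → E N N + ∑ n ∈ Finset.Ico 1 N,
      (E (N + n : ℕ) (N - n : ℕ) + E (N - n : ℕ) (N + n : ℕ)) = 0) :
    symSum 1 E ∈ errors := by
  obtain ⟨q, C, p, hC, hq⟩ := exists_approx hE
  have happ : ∀ A B N : ℕ, 1 ≤ A → 1 ≤ B → A + B = 2 * N →
      |E A B - q.eval (mhs [1] A)| ≤
        C * 4 ^ p * ell N ^ (2 * p) * ((√(A : ℝ))⁻¹ + (√(B : ℝ))⁻¹) := by
    intro A B N hA hB hAB
    have h1 : ell A ≤ 2 * ell N := (ell_mono (by omega)).trans (ell_two_mul_le N)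
    have h2 : ell B ≤ 2 * ell N := (ell_mono (by omega)).trans (ell_two_mul_le N)
    have lA := one_le_ell A
    have lB := one_le_ell B
    have lN : 0 ≤ 2 * ell N := by linarith
    refine (hq A B hA hB).trans ?_
    calc _ ≤ C * (2 * ell N * (2 * ell N)) ^ p * ((√(A : ℝ))⁻¹ + (√(B : ℝ))⁻¹) := by gcongr
      _ = _ := by
        rw [show 2 * ell N * (2 * ell N) = 4 * ell N ^ 2 by ring, mul_pow, ← pow_mul]
        ring
  set K : ℕ → ℝ := fun N => C * 4 ^ p * ell N ^ (2 * p) with hK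
  have hK0 : ∀ N, 0 ≤ K N := fun N => by have := one_le_ell N; simp only [hK]; positivity
  have hpair : ∀ N n : ℕ, n ∈ Finset.Ico 1 N →
      |E (N + n : ℕ) (N - n : ℕ) - q.eval (mhs [1] (N + n))| ≤ K N * (2 * (√((N - n : ℕ) : ℝ))⁻¹) ∧
      |E (N - n : ℕ) (N + n : ℕ) - q.eval (mhs [1] (N - n))| ≤
        K N * (2 * (√((N - n : ℕ) : ℝ))⁻¹) := by
    intro N n hn
    have hn := Finset.mem_Ico.1 hn
    have hle : (√((N + n : ℕ) : ℝ))⁻¹ ≤ (√((N - n : ℕ) : ℝ))⁻¹ := by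
      refine inv_anti₀ (by linarith [one_le_sqrt_natCast (show 1 ≤ N - n by omega)]) ?_
      exact Real.sqrt_le_sqrt (by exact_mod_cast (show N - n ≤ N + n by omega))
    constructor
    · refine (happ _ _ N (by omega) (by omega) (by omega)).trans ?_
      exact mul_le_mul_of_nonneg_left (by linarith) (hK0 N)
    · refine (happ _ _ N (by omega) (by omega) (by omega)).trans ?_
      exact mul_le_mul_of_nonneg_left (by linarith) (hK0 N)
  have hq0 : q = 0 := by
    refine eq_zero_of_sum_eval_le (C := C * 4 ^ p * 14) (p := 2 * p) (by positivity)
      fun N hN => ?_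
    have hsN := one_le_sqrt_natCast hN
    rw [sum_Ico_symm _ hN]
    have e : q.eval (mhs [1] N) + ∑ n ∈ Finset.Ico 1 N,
        (q.eval (mhs [1] (N + n)) + q.eval (mhs [1] (N - n))) =
        -((E N N - q.eval (mhs [1] N)) + ∑ n ∈ Finset.Ico 1 N,
          ((E (N + n : ℕ) (N - n : ℕ) - q.eval (mhs [1] (N + n))) +
          (E (N - n : ℕ) (N + n : ℕ) - q.eval (mhs [1] (N - n))))) := by
      have := h0 N hN
      simp only [Finset.sum_add_distrib, Finset.sum_sub_distrib] at this ⊢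
      linarith
    rw [e, abs_neg]
    have b0 : |E N N - q.eval (mhs [1] N)| ≤ K N * 2 := by
      refine (happ N N N hN hN (by omega)).trans ?_
      refine mul_le_mul_of_nonneg_left ?_ (hK0 N)
      have := inv_le_one_of_one_le₀ hsN
      linarith
    have b1 : |∑ n ∈ Finset.Ico 1 N,
          ((E (N + n : ℕ) (N - n : ℕ) - q.eval (mhs [1] (N + n))) +
          (E (N - n : ℕ) (N + n : ℕ) - q.eval (mhs [1] (N - n))))| ≤
        ∑ n ∈ Finset.Ico 1 N, K N * 4 * (√((N - n : ℕ) : ℝ))⁻¹ := by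
      refine (Finset.abs_sum_le_sum_abs _ _).trans (Finset.sum_le_sum fun n hn => ?_)
      obtain ⟨p1, p2⟩ := hpair N n hn
      refine (abs_add_le _ _).trans ?_
      linarith
    have b2 : ∑ n ∈ Finset.Ico 1 N, (√((N - n : ℕ) : ℝ))⁻¹ ≤ 3 * √(N : ℝ) := by
      refine le_trans (le_of_eq ?_) (sum_inv_sqrt_le N)
      refine Finset.sum_nbij' (fun A => N - A) (fun n => N - n) ?_ ?_ ?_ ?_ ?_ <;>
        intro m hm <;> simp only [Finset.mem_Ico] at * <;> omega
    rw [← Finset.mul_sum] at b1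
    have b3 := mul_le_mul_of_nonneg_left b2 (mul_nonneg (hK0 N) (by norm_num : (0 : ℝ) ≤ 4))
    have b4 : K N * 2 ≤ K N * 2 * √(N : ℝ) :=
      le_mul_of_one_le_right (mul_nonneg (hK0 N) (by norm_num)) hsN
    refine (abs_add_le _ _).trans ?_
    calc _ ≤ K N * 2 * √(N : ℝ) + K N * 4 * (3 * √(N : ℝ)) := by linarith
      _ = _ := by simp only [hK]; ring
  subst hq0
  simp only [Polynomial.eval_zero, sub_zero] at hpair
  refine mem_errors.2 ⟨8 * (C * 4 ^ p), 2 * p + 1, by positivity, fun N hN => ?_⟩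
  have hN' : (0 : ℝ) < N := by exact_mod_cast hN
  have hs0 : 0 < √(N : ℝ) := Real.sqrt_pos.2 hN'
  have hb : ∀ n ∈ Finset.Ico 1 N, |((n : ℝ) ^ 1)⁻¹ *
      (E (N + n : ℕ) (N - n : ℕ) + (-1) ^ 1 * E (N - n : ℕ) (N + n : ℕ))| ≤
      4 * K N * (√(N : ℝ))⁻¹ * ((n : ℝ)⁻¹ + ((N - n : ℕ) : ℝ)⁻¹) := by
    intro n hn
    obtain ⟨p1, p2⟩ := hpair N n hn
    have hn := Finset.mem_Ico.1 hn
    have hn' : (0 : ℝ) < n := by exact_mod_cast hn.1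
    set m : ℝ := ((N - n : ℕ) : ℝ) with hm
    have hm' : 0 < m := by rw [hm]; exact_mod_cast (show 0 < N - n by omega)
    have hmn : (n : ℝ) + m = N := by rw [hm]; push_cast [hn.2.le]; ring
    have hsm : √m ≤ √(N : ℝ) := Real.sqrt_le_sqrt (by linarith)
    have hsm0 : 0 < √m := Real.sqrt_pos.2 hm'
    have key : (n : ℝ)⁻¹ * (√m)⁻¹ ≤ (√(N : ℝ))⁻¹ * ((n : ℝ)⁻¹ + m⁻¹) := by
      have e1 : (n : ℝ)⁻¹ + m⁻¹ = N * ((n : ℝ)⁻¹ * m⁻¹) := by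
        rw [← hmn]; field_simp; ring
      have e2 : (√(N : ℝ))⁻¹ * N = √(N : ℝ) := by
        rw [inv_mul_eq_iff_eq_mul₀ hs0.ne', Real.mul_self_sqrt hN'.le]
      have e3 : (√m)⁻¹ = √m * m⁻¹ := by
        rw [inv_eq_iff_eq_inv, mul_inv, inv_inv, eq_comm, inv_mul_eq_iff_eq_mul₀ hsm0.ne',
          Real.mul_self_sqrt hm'.le]
      rw [e1, ← mul_assoc, e2, e3]
      calc (n : ℝ)⁻¹ * (√m * m⁻¹) = √m * ((n : ℝ)⁻¹ * m⁻¹) := by ring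
        _ ≤ _ := by gcongr
    rw [pow_one, pow_one, abs_mul, abs_of_nonneg (by positivity : (0 : ℝ) ≤ (n : ℝ)⁻¹)]
    calc _ ≤ (n : ℝ)⁻¹ * (K N * (2 * (√m)⁻¹) + K N * (2 * (√m)⁻¹)) := by
          refine mul_le_mul_of_nonneg_left ((abs_add_le _ _).trans ?_) (by positivity)
          rw [abs_mul, abs_neg, abs_one, one_mul]
          exact add_le_add p1 p2
      _ = 4 * K N * ((n : ℝ)⁻¹ * (√m)⁻¹) := by ring
      _ ≤ 4 * K N * ((√(N : ℝ))⁻¹ * ((n : ℝ)⁻¹ + m⁻¹)) :=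
          mul_le_mul_of_nonneg_left key (mul_nonneg (by norm_num) (hK0 N))
      _ = _ := by ring
  have hsum : |symSum 1 E N| ≤ 4 * K N * (√(N : ℝ))⁻¹ * (2 * ell N) := by
    refine (Finset.abs_sum_le_sum_abs _ _).trans ((Finset.sum_le_sum hb).trans ?_)
    rw [← Finset.mul_sum, Finset.sum_add_distrib]
    have e : ∑ n ∈ Finset.Ico 1 N, ((N - n : ℕ) : ℝ)⁻¹ = mhs [1] N := by
      rw [mhs_one]
      refine Finset.sum_nbij' (fun A => N - A) (fun n => N - n) ?_ ?_ ?_ ?_ ?_ <;>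
        intro m hm <;> simp only [Finset.mem_Ico] at * <;> omega
    rw [e, ← mhs_one]
    refine mul_le_mul_of_nonneg_left ?_
      (mul_nonneg (mul_nonneg (by norm_num) (hK0 N)) (by positivity))
    unfold ell
    linarith
  calc √(N : ℝ) * |symSum 1 E N| ≤ √(N : ℝ) * (4 * K N * (√(N : ℝ))⁻¹ * (2 * ell N)) := by gcongr
    _ = 8 * K N * ell N := by field_simp; ring
    _ = _ := by simp only [hK]; ring

end Sums

section Main

theorem regular_congr {r : ℕ} {a b : ℕ → ℝ} (ha : a ∈ regular r)
    (h : ∀ N, 1 ≤ N → a N = b N) : b ∈ regular r := by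
  have h1 : b - a ∈ errors := mem_errors.2 ⟨0, 0, le_rfl, fun N hN => by simp [h N hN]⟩
  have := (regular r).add_mem ha (errors_le_regular h1 r)
  rwa [add_sub_cancel] at this

/-- The sum of `∏ n_i ^ (-k_i)` over nonzero integers `-N < n_1 < ⋯ < n_d < N`. -/
noncomputable def bilateral (w : List ℕ) (N : ℕ) : ℝ :=
  conv (mhs · N) (fun u => chain powInv u (-N) 0) w

/-- Bilateral sums have smaller depth than expected. -/
theorem bilateral_mem_regular {w : List ℕ} (hw : Adm w) (hne : w ≠ []) :
    bilateral w ∈ regular (w.length - 1) := by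
  obtain ⟨k, u, rfl⟩ := List.exists_cons_of_ne_nil hne
  set w := k :: u
  have hsum : 2 ≤ w.sum := by
    have := (adm_cons.1 hw).1
    simp only [w, List.sum_cons]
    omega
  set E0 : ℤ → ℤ → ℝ := ∑ i ∈ Finset.range w.length, coefTerm w i (w.getD i 0 - 1) with hE0
  have hE0mem : E0 ∈ Submodule.span ℚ (twoSided (w.length - 1)) :=
    Submodule.sum_mem _ fun i hi => coefTerm_mem hw (Finset.mem_range.1 hi) _
  have hE0app : ∀ A B : ℤ, E0 A B =
      ∑ i ∈ Finset.range w.length, coefTerm w i (w.getD i 0 - 1) A B := fun A B => by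
    simp only [hE0, Finset.sum_apply]
  have herr : symSum 1 E0 ∈ errors := by
    refine symSum_one_mem_errors hE0mem fun N hN => ?_
    have h := sum_coefTerm_eq_zero hw.1 hsum (N : ℤ)
    simp only [← hE0app] at h
    rw [← Finset.add_sum_erase _ _
      (show (0 : ℤ) ∈ Finset.Ioo (-(N : ℤ)) N by simp; omega), sum_Ioo_symm] at h
    rw [add_zero, sub_zero] at h
    rw [← h]
    congr 1
    refine Finset.sum_congr rfl fun n hn => ?_
    have hn := (Finset.mem_Ico.1 hn).2
    push_cast [hn.le]
    rw [sub_neg_eq_add, ← sub_eq_add_neg]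
  have hdiag : (∑ i ∈ Finset.range w.length, fun N : ℕ => coefTerm w i (w.getD i 0) N N) ∈
      regular (w.length - 1) :=
    Submodule.sum_mem _ fun i hi =>
      diagonal_mem_regular (coefTerm_mem hw (Finset.mem_range.1 hi) _)
  have hhigh : (∑ i ∈ Finset.range w.length, ∑ j ∈ Finset.range (w.getD i 0 - 1),
      symSum (j + 2) (coefTerm w i (w.getD i 0 - 2 - j))) ∈ regular (w.length - 1) :=
    Submodule.sum_mem _ fun i hi => Submodule.sum_mem _ fun j _ =>
      symSum_mem_regular (by omega) (coefTerm_mem hw (Finset.mem_range.1 hi) _)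
  refine regular_congr ((regular _).sub_mem
    ((regular _).add_mem hhigh (errors_le_regular herr _)) hdiag) fun N hN => ?_
  have key := conv_eq_sum_coefTerm hw.1 (by omega) (N := (N : ℤ)) (by omega)
  rw [bilateral]
  simp only [mhs]
  rw [key]
  simp only [Pi.sub_apply, Pi.add_apply, Finset.sum_apply]
  congr 1
  rw [Finset.sum_comm]
  have h1 : symSum 1 E0 N = ∑ i ∈ Finset.range w.length,
      symSum 1 (coefTerm w i (w.getD i 0 - 1)) N := by
    simp only [← sum_powInv_eq_symSum, hE0app, Finset.mul_sum]
    rw [Finset.sum_comm]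
  rw [h1, ← Finset.sum_add_distrib]
  refine Finset.sum_congr rfl fun i hi => ?_
  obtain ⟨m, hm⟩ : ∃ m, w.getD i 0 = m + 1 :=
    ⟨w.getD i 0 - 1, by have := getD_pos hw.1 hi; omega⟩
  rw [Finset.sum_comm, hm, Nat.add_sub_cancel, Finset.sum_range_succ']
  simp only [sum_powInv_eq_symSum, Nat.sub_zero, zero_add]
  congr 1
  refine Finset.sum_congr rfl fun j _ => ?_
  congr 2
  omega

theorem starSum_mem_regular {w : List ℕ} (hw : ∀ x ∈ w, 1 ≤ x) :
    starSum w ∈ regular w.length := by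
  obtain ⟨T, hT, h⟩ := exists_starSum_eq w
  have h1 := list_sum_mem_regular (r := w.length) T fun c hc =>
    regular_mono (hT c hc).1.le (mhs_mem_regular ((hT c hc).2.1 hw))
  convert (regular _).add_mem (mhs_mem_regular hw) h1 using 1
  ext N
  exact h N

theorem negInv_mem_regular {w : List ℕ} (hw : ∀ x ∈ w, 1 ≤ x) :
    (fun N => negInv N w) ∈ regular w.length := by
  convert (regular _).smul_mem ((-1 : ℚ) ^ (w.length + w.sum)) (starSum_mem_regular hw) using 1
  ext N
  simp only [Pi.smul_apply, Rat.smul_def, negInv]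
  push_cast
  rfl

/-- The parity result for words. -/
theorem mhs_mem_regular_of_parity {w : List ℕ} (hw : Adm w) (hodd : Odd (w.length + w.sum)) :
    mhs w ∈ regular (w.length - 1) := by
  obtain ⟨T, hT, hstar⟩ := exists_starSum_eq w
  have hTmem : (fun N => (T.map (mhs · N)).sum) ∈ regular (w.length - 1) :=
    list_sum_mem_regular T fun c hc => by
      have hc' := hT c hc
      exact regular_mono (by omega) (mhs_mem_regular (hc'.2.1 hw.1))
  have hF : (∑ i ∈ Finset.range w.length,
      bilateral (w.take (i + 1)) * fun N => negInv N (w.drop (i + 1))) ∈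
      regular (w.length - 1) := by
    refine Submodule.sum_mem _ fun i hi => ?_
    have hi := Finset.mem_range.1 hi
    have h1 := bilateral_mem_regular (hw.take (i + 1)) (by
      intro h
      have := congrArg List.length h
      simp only [List.length_take, List.length_nil] at this
      omega)
    have h2 := negInv_mem_regular (w := w.drop (i + 1))
      fun x hx => hw.1 x (List.mem_of_mem_drop hx)
    refine regular_mono ?_ (mul_mem_regular h1 h2)
    rw [List.length_take, List.length_drop]
    omega
  refine regular_congr ((regular _).smul_mem (2⁻¹ : ℚ) ((regular _).sub_mem hF hTmem))
    fun N hN => ?_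
  have key := mhs_eq_conv hN w
  rw [conv, Finset.sum_range_succ'] at key
  simp only [List.take_zero, List.drop_zero] at key
  rw [conv_nil, mhs_nil, chain_nil, one_mul, one_mul, negInv, hodd.neg_one_pow, hstar N] at key
  simp only [Pi.smul_apply, Pi.sub_apply, Finset.sum_apply, Pi.mul_apply, Rat.smul_def, bilateral]
  push_cast
  linarith

end Main

end MZVParity

theorem theorem1p1 (d : ℕ) (k : Fin d → ℕ) (hk : MZV.Admissible k)
    (hpar : ¬ (∑ i, k i) ≡ d [MOD 2]) :
    MZV.zeta k ∈ Submodule.span MZV.ratPiSq (MZV.valuesOfDepthLE (d - 1)) := by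
  open MZVParity in
  have hadm := adm_reverse_ofFn hk
  have hlen : (List.ofFn k).reverse.length = d := by simp
  have hsum : (List.ofFn k).reverse.sum = ∑ i, k i := by
    rw [List.sum_reverse, List.sum_ofFn]
  have hodd : Odd ((List.ofFn k).reverse.length + (List.ofFn k).reverse.sum) := by
    rw [hlen, hsum, Nat.odd_iff]
    unfold Nat.ModEq at hpar
    omega
  have h1 := mhs_mem_regular_of_parity hadm hodd
  rw [hlen] at h1
  have h2 := errors_le_regular (mhs_sub_mem_errors hadm (tendsto_mhs_zeta hk)) (d - 1)
  refine mem_depthSpan_of_const_mem_regular ?_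
  convert (regular (d - 1)).sub_mem h1 h2 using 1
  ext N
  simp
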